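/- Let $I=(-\frac{\pi}{2},\frac{\pi}{2})$ and let $L^2(I,d\theta)$ be the space of square-integrable complex functions on $I$, with $\langle\phi|\psi\rangle=\int_I\overline{\phi(\theta)}\,\psi(\theta)\,d\theta$. For $a>0$ put $$\theta_a=\arctan(a\tan\theta),\qquad \lambda(a,\theta)=\frac{a}{a^2+(1-a^2)\cos^2\theta}$$ (both depend on $\theta$ only modulo $\pi$), and for $\gamma\in L^2(I,d\theta)$, $\vartheta\in I$ and $a\in\mathbb{R}^+=(0,\infty)$ let $$\gamma_{\vartheta,a}(\theta)=\lambda(1/a,\theta-\vartheta)^{1/2}\,\gamma\big((\theta-\vartheta)_{1/a}\big),\qquad \theta\in I,$$ which is again an element of $L^2(I,d\theta)$. Call $\gamma$ admissible if $\gamma\neq 0$ and $$\int_0^\infty\frac{da}{a^2}\int_{-\pi/2}^{\pi/2}d\vartheta\,|\langle\gamma_{\vartheta,a}|\psi\rangle|^2<\infty\quad\text{for all }\psi\in L^2(I,d\theta),$$ and even if $\gamma(-\theta)=\gamma(\theta)$ for almost every $\theta\in I$. For any even admissible $\gamma\in L^2(I,d\theta)$, the family $\{\gamma_{\vartheta,a}:(\vartheta,a)\in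 I\times\mathbb{R}^+\}$ is a continuous frame with respect to the measure $d\vartheta\,da/a^2$; that is, $(\vartheta,a)\mapsto\langle\gamma_{\vartheta,a}|\psi\rangle$ is measurable for every $\psi$, and there exist constants $0<c_1\le c_2$ such that $$c_1\|\psi\|^2\le\int_0^\infty\frac{da}{a^2}\int_{-\pi/2}^{\pi/2}d\vartheta\,|\langle\gamma_{\vartheta,a}|\psi\rangle|^2\le c_2\|\psi\|^2\qquad\text{for all }\psi\in L^2(I,d\theta).$$ -/

import Mathlib

open MeasureTheory Set

namespace CircleWavelet

/-- The interval `(-π/2, π/2)`, viewed as the half circle (the circle modulo `π`). -/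
def arc : Set ℝ := Ioo (-(Real.pi / 2)) (Real.pi / 2)

/-- The signal space `L²((-π/2, π/2), dθ)`. -/
abbrev Signal : Type := Lp ℂ 2 (volume.restrict arc)

/-- The dilated angle `θ_a = arctan (a tan θ)`. It depends on `θ` only modulo `π` and takes values
in `(-π/2, π/2)`. -/
noncomputable def dilate (a θ : ℝ) : ℝ := Real.arctan (a * Real.tan θ)

/-- The multiplier `λ(a, θ) = a / (a² + (1 - a²) cos² θ)`. -/
noncomputable def multiplier (a θ : ℝ) : ℝ := a / (a ^ 2 + (1 - a ^ 2) * Real.cos θ ^ 2)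

/-- The function `θ ↦ λ(1/a, θ - ϑ)^{1/2} γ((θ - ϑ)_{1/a})`, for a function `γ` on `(-π/2, π/2)`.
No periodic extension of `γ` is needed, as `γ` is only evaluated at dilated angles. -/
noncomputable def transformFun (ϑ a : ℝ) (γ : ℝ → ℂ) (θ : ℝ) : ℂ :=
  ((Real.sqrt (multiplier (1 / a) (θ - ϑ)) : ℝ) : ℂ) * γ (dilate (1 / a) (θ - ϑ))

theorem multiplier_nonneg {a : ℝ} (ha : 0 < a) (θ : ℝ) : 0 ≤ multiplier a θ := by
  unfold multiplier
  have h : a ^ 2 + (1 - a ^ 2) * Real.cos θ ^ 2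
      = a ^ 2 * Real.sin θ ^ 2 + Real.cos θ ^ 2 := by
    rw [Real.sin_sq]; ring
  rw [h]
  positivity

theorem measurable_tan : Measurable Real.tan := by
  have : Real.tan = fun x => Real.sin x / Real.cos x := by
    funext x; exact Real.tan_eq_sin_div_cos x
  rw [this]
  exact Real.measurable_sin.div Real.measurable_cos

theorem stronglyMeasurable_transformFun {γ : ℝ → ℂ} (hγ : StronglyMeasurable γ) (ϑ a : ℝ) :
    StronglyMeasurable (transformFun ϑ a γ) := by
  have h2 : Measurable fun θ : ℝ => dilate (1 / a) (θ - ϑ) :=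
    Real.measurable_arctan.comp
      ((measurable_tan.comp (measurable_id.sub_const ϑ)).const_mul (1 / a))
  have h1 : Measurable fun θ : ℝ =>
      ((Real.sqrt (multiplier (1 / a) (θ - ϑ)) : ℝ) : ℂ) := by
    unfold multiplier
    fun_prop
  exact h1.stronglyMeasurable.mul (hγ.comp_measurable h2)

theorem hasDerivAt_dilate {b : ℝ} {x : ℝ} (hx : x ∈ arc) :
    HasDerivAt (dilate b) (multiplier b x) x := by
  have hc : Real.cos x ≠ 0 := (Real.cos_pos_of_mem_Ioo hx).ne'
  have h := ((Real.hasDerivAt_tan_of_mem_Ioo hx).const_mul b).arctan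
  refine h.congr_deriv ?_
  unfold multiplier
  have h1 : 1 + (b * Real.tan x) ^ 2 ≠ 0 := by positivity
  have h2 : b ^ 2 + (1 - b ^ 2) * Real.cos x ^ 2
      = (1 + (b * Real.tan x) ^ 2) * Real.cos x ^ 2 := by
    rw [Real.tan_eq_sin_div_cos]
    field_simp
    rw [Real.sin_sq]; ring
  rw [h2]
  field_simp

theorem injOn_dilate {b : ℝ} (hb : 0 < b) : InjOn (dilate b) arc := by
  intro x hx y hy h
  have h1 := Real.arctan_injective h
  exact Real.injOn_tan hx hy (mul_left_cancel₀ hb.ne' h1)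

theorem image_dilate {b : ℝ} (hb : 0 < b) : dilate b '' arc = arc := by
  ext y
  constructor
  · rintro ⟨x, -, rfl⟩
    exact Real.arctan_mem_Ioo _
  · intro hy
    refine ⟨Real.arctan (Real.tan y / b), Real.arctan_mem_Ioo _, ?_⟩
    unfold dilate
    rw [Real.tan_arctan, mul_div_cancel₀ _ hb.ne', Real.arctan_tan hy.1 hy.2]

theorem lintegral_dilate {b : ℝ} (hb : 0 < b) (g : ℝ → ENNReal) :
    ∫⁻ x in arc, ENNReal.ofReal (multiplier b x) * g (dilate b x) = ∫⁻ x in arc, g x := by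
  have h := lintegral_image_eq_lintegral_abs_deriv_mul (s := arc) (f := dilate b)
    (f' := multiplier b) measurableSet_Ioo
    (fun x hx => (hasDerivAt_dilate hx).hasDerivWithinAt) (injOn_dilate hb) g
  rw [image_dilate hb] at h
  rw [h]
  simp_rw [abs_of_nonneg (multiplier_nonneg hb _)]

theorem lintegral_rotate (h : ℝ → ENNReal) (hp : Function.Periodic h Real.pi) (ϑ : ℝ) :
    ∫⁻ x in arc, h (x - ϑ) = ∫⁻ x in arc, h x := by
  have hA : ∀ f : ℝ → ENNReal, ∫⁻ x in arc, f x
      = ∫⁻ x in Ioc (-(Real.pi / 2)) (-(Real.pi / 2) + Real.pi), f x := by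
    intro f
    have : -(Real.pi / 2) + Real.pi = Real.pi / 2 := by ring
    rw [this]
    exact setLIntegral_congr Ioo_ae_eq_Ioc
  rw [hA, hA]
  have hmp := (measurePreserving_sub_right (volume : Measure ℝ) ϑ).setLIntegral_comp_preimage_emb
    (MeasurableEquiv.subRight ϑ).measurableEmbedding h
    (Ioc (-(Real.pi / 2) - ϑ) (-(Real.pi / 2) - ϑ + Real.pi))
  have hpre : (fun x => x - ϑ) ⁻¹' Ioc (-(Real.pi / 2) - ϑ) (-(Real.pi / 2) - ϑ + Real.pi)
      = Ioc (-(Real.pi / 2)) (-(Real.pi / 2) + Real.pi) := by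
    ext x
    simp only [mem_preimage, mem_Ioc]
    constructor <;> rintro ⟨h1, h2⟩ <;> constructor <;> linarith
  rw [hpre] at hmp
  rw [hmp]
  exact IsAddFundamentalDomain.setLIntegral_eq (isAddFundamentalDomain_Ioc Real.pi_pos _)
    (isAddFundamentalDomain_Ioc Real.pi_pos _) h hp.map_vadd_zmultiples

/-- The transformation preserves the `L²` norm. -/
theorem lintegral_transformFun {a : ℝ} (ha : 0 < a) (ϑ : ℝ) (γ : ℝ → ℂ) :
    ∫⁻ θ in arc, ‖transformFun ϑ a γ θ‖ₑ ^ 2 = ∫⁻ θ in arc, ‖γ θ‖ₑ ^ 2 := by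
  have hb : 0 < 1 / a := by positivity
  rw [← lintegral_dilate hb (fun x => ‖γ x‖ₑ ^ 2), ← lintegral_rotate
    (fun x => ENNReal.ofReal (multiplier (1 / a) x) * ‖γ (dilate (1 / a) x)‖ₑ ^ 2) ?_ ϑ]
  · refine lintegral_congr fun θ => ?_
    unfold transformFun
    rw [enorm_mul, mul_pow]
    congr 1
    rw [← ofReal_norm, Complex.norm_real, Real.norm_of_nonneg (Real.sqrt_nonneg _),
      ← ENNReal.ofReal_pow (Real.sqrt_nonneg _), Real.sq_sqrt (multiplier_nonneg hb _)]
  · intro x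
    simp only [multiplier, dilate, Real.cos_add_pi, Real.tan_periodic x, neg_sq]

theorem memLp_transformFun {a : ℝ} (ha : 0 < a) (ϑ : ℝ) (γ : Signal) :
    MemLp (transformFun ϑ a γ) 2 (volume.restrict arc) := by
  refine ⟨(stronglyMeasurable_transformFun (Lp.stronglyMeasurable γ) ϑ a).aestronglyMeasurable,
    ?_⟩
  have h := (Lp.memLp γ).2
  rw [eLpNorm_lt_top_iff_lintegral_rpow_enorm_lt_top (by norm_num) (by norm_num)] at h ⊢
  simp only [ENNReal.toReal_ofNat, ENNReal.rpow_ofNat] at h ⊢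
  rwa [lintegral_transformFun ha]

/-- The parameter space `(-π/2, π/2) × ℝ⁺` of pairs `(ϑ, a)`. -/
abbrev Param : Type := arc × Ioi (0 : ℝ)

/-- The measure `dϑ da / a²` on the parameter space. -/
noncomputable def paramMeasure : Measure Param :=
  (Measure.comap ((↑) : arc → ℝ) volume).prod
    ((Measure.comap ((↑) : Ioi (0 : ℝ) → ℝ) volume).withDensity
      fun a => ENNReal.ofReal (1 / (a : ℝ) ^ 2))

/-- The element `γ_{ϑ,a}` of `L²((-π/2, π/2), dθ)`. -/
noncomputable def wavelet (γ : Signal) (q : Param) : Signal :=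
  (memLp_transformFun q.2.2 (q.1 : ℝ) γ).toLp (transformFun q.1 q.2 γ)

/-- `γ` is admissible: it is non-zero and `∫ |⟨γ_{ϑ,a} | ψ⟩|² dϑ da / a² < ∞` for all `ψ`. -/
def IsAdmissible (γ : Signal) : Prop :=
  γ ≠ 0 ∧ ∀ ψ : Signal, ∫⁻ q, ‖inner ℂ (wavelet γ q) ψ‖ₑ ^ 2 ∂paramMeasure < ⊤

/-- `γ` is even: `γ(-θ) = γ(θ)` for almost every `θ`. -/
def IsEven (γ : Signal) : Prop :=
  ∀ᵐ θ ∂(volume.restrict arc), γ (-θ) = γ θ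

/-- A family `e` of vectors of a Hilbert space, indexed by a measure space, is a continuous frame
if it is weakly measurable and `c₁ ‖ψ‖² ≤ ∫ |⟨e_q | ψ⟩|² dμ(q) ≤ c₂ ‖ψ‖²` for all `ψ`, with
constants `0 < c₁ ≤ c₂`. -/
def IsContinuousFrame {Q H : Type*} [MeasurableSpace Q] [NormedAddCommGroup H]
    [InnerProductSpace ℂ H] (μ : Measure Q) (e : Q → H) : Prop :=
  (∀ ψ : H, Measurable fun q => inner ℂ (e q) ψ) ∧
  ∃ c₁ c₂ : ℝ, 0 < c₁ ∧ c₁ ≤ c₂ ∧ ∀ ψ : H,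
    ENNReal.ofReal (c₁ * ‖ψ‖ ^ 2) ≤ ∫⁻ q, ‖inner ℂ (e q) ψ‖ₑ ^ 2 ∂μ ∧
    ∫⁻ q, ‖inner ℂ (e q) ψ‖ₑ ^ 2 ∂μ ≤ ENNReal.ofReal (c₂ * ‖ψ‖ ^ 2)

end CircleWavelet

namespace CircleWavelet

section

open Filter Topology FourierTransform
open scoped ENNReal NNReal

theorem mul_le_min_add {a b : ℝ≥0∞} {δ : ℝ≥0} (hδ : δ ≠ 0) :
    a * b ≤ min (a * b) (a ^ 2 / δ) + δ * b ^ 2 := by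
  rcases le_total a (δ * b) with h | h
  · calc a * b ≤ δ * b * b := by gcongr
      _ = δ * b ^ 2 := by ring
      _ ≤ _ := le_add_self
  · have : a * b ≤ a ^ 2 / δ := by
      rw [ENNReal.le_div_iff_mul_le (by simp [hδ]) (by simp)]
      calc a * b * δ = a * (δ * b) := by ring
        _ ≤ a * a := by gcongr
        _ = a ^ 2 := by ring
    rw [min_eq_left this]
    exact le_self_add

/-- A pointwise null net that is bounded in `L²` converges weakly to zero. -/
theorem tendsto_integral_mul_of_sq_bounded {α ι : Type*} [MeasurableSpace α] {μ : Measure α}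
    {l : Filter ι} [l.IsCountablyGenerated] {f : α → ℂ} (hf : MemLp f 2 μ) {k : ι → α → ℝ}
    (hk : ∀ i, Measurable (k i)) {M : ℝ≥0∞} (hM : M ≠ ∞)
    (hb : ∀ᶠ i in l, ∫⁻ x, ‖k i x‖ₑ ^ 2 ∂μ ≤ M)
    (h0 : ∀ᵐ x ∂μ, Tendsto (fun i => k i x) l (𝓝 0)) :
    Tendsto (fun i => ∫ x, f x * k i x ∂μ) l (𝓝 0) := by
  have hf2 : ∫⁻ x, ‖f x‖ₑ ^ 2 ∂μ ≠ ∞ := by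
    have h := hf.2
    rw [eLpNorm_lt_top_iff_lintegral_rpow_enorm_lt_top (by norm_num) (by norm_num)] at h
    simpa using h.ne
  have hfm : AEMeasurable (fun x => ‖f x‖ₑ) μ := hf.1.enorm
  have key : Tendsto (fun i => ∫⁻ x, ‖f x‖ₑ * ‖k i x‖ₑ ∂μ) l (𝓝 0) := by
    rw [ENNReal.tendsto_nhds_zero]
    intro ε hε
    obtain ⟨δ, hδ0, hδ⟩ : ∃ δ : ℝ≥0, δ ≠ 0 ∧ δ * M ≤ ε / 2 := by
      obtain ⟨δ, hδ0, hδ⟩ := ENNReal.exists_nnreal_pos_mul_lt hM (ENNReal.half_pos hε.ne').ne'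
      exact ⟨δ, hδ0.ne', hδ.le⟩
    have hlim : Tendsto (fun i => ∫⁻ x, min (‖f x‖ₑ * ‖k i x‖ₑ) (‖f x‖ₑ ^ 2 / δ) ∂μ) l
        (𝓝 (∫⁻ _, 0 ∂μ)) := by
      refine tendsto_lintegral_filter_of_dominated_convergence' (fun x => ‖f x‖ₑ ^ 2 / δ) ?_ ?_ ?_ ?_
      · exact Eventually.of_forall fun i =>
          (hfm.mul (hk i).enorm.aemeasurable).min ((hfm.pow_const 2).div_const _)
      · exact Eventually.of_forall fun i => Eventually.of_forall fun x => min_le_right _ _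
      · simp_rw [div_eq_mul_inv]
        rw [lintegral_mul_const' _ _ (by simp [hδ0])]
        exact ENNReal.mul_ne_top hf2 (by simp [hδ0])
      · filter_upwards [h0] with x hx
        have h1 : Tendsto (fun i => ‖f x‖ₑ * ‖k i x‖ₑ) l (𝓝 0) := by
          have h2 : Tendsto (fun i => ‖k i x‖ₑ) l (𝓝 0) := by
            simpa using hx.enorm
          simpa using ENNReal.Tendsto.const_mul h2 (Or.inr enorm_ne_top)
        exact tendsto_of_tendsto_of_tendsto_of_le_of_le tendsto_const_nhds h1 (fun _ => zero_le)
          (fun _ => min_le_left _ _)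
    rw [lintegral_zero] at hlim
    filter_upwards [hb, (ENNReal.tendsto_nhds_zero.1 hlim) (ε / 2) (ENNReal.half_pos hε.ne')]
      with i hi hi'
    calc ∫⁻ x, ‖f x‖ₑ * ‖k i x‖ₑ ∂μ
        ≤ ∫⁻ x, (min (‖f x‖ₑ * ‖k i x‖ₑ) (‖f x‖ₑ ^ 2 / δ) + δ * ‖k i x‖ₑ ^ 2) ∂μ :=
          lintegral_mono fun x => mul_le_min_add hδ0
      _ = ∫⁻ x, min (‖f x‖ₑ * ‖k i x‖ₑ) (‖f x‖ₑ ^ 2 / δ) ∂μ + δ * ∫⁻ x, ‖k i x‖ₑ ^ 2 ∂μ := by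
          rw [lintegral_add_right _ (((hk i).enorm.pow_const 2).const_mul _),
            lintegral_const_mul _ ((hk i).enorm.pow_const 2)]
      _ ≤ ε / 2 + δ * M := by gcongr
      _ ≤ ε / 2 + ε / 2 := by gcongr
      _ = ε := ENNReal.add_halves ε
  rw [tendsto_zero_iff_enorm_tendsto_zero]
  refine tendsto_of_tendsto_of_tendsto_of_le_of_le tendsto_const_nhds key (fun _ => zero_le) ?_
  intro i
  refine (enorm_integral_le_lintegral_enorm _).trans (lintegral_mono fun x => ?_)
  rw [enorm_mul]
  gcongr
  rw [← ofReal_norm, Complex.norm_real, ofReal_norm]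

/-- A weakly measurable family with finite Bessel integrals has a Bessel bound. -/
theorem exists_bessel_bound {Q H : Type*} [MeasurableSpace Q] [NormedAddCommGroup H]
    [InnerProductSpace ℂ H] [CompleteSpace H] {μ : Measure Q} {e : Q → H}
    (hm : ∀ ψ : H, Measurable fun q => inner ℂ (e q) ψ)
    (hfin : ∀ ψ : H, ∫⁻ q, ‖inner ℂ (e q) ψ‖ₑ ^ 2 ∂μ < ∞) :
    ∃ C : ℝ, 0 ≤ C ∧ ∀ ψ : H, ∫⁻ q, ‖inner ℂ (e q) ψ‖ₑ ^ 2 ∂μ ≤ ENNReal.ofReal (C * ‖ψ‖ ^ 2) := by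
  have hL : ∀ ψ : H, MemLp (fun q => inner ℂ (e q) ψ) 2 μ := fun ψ => by
    refine ⟨(hm ψ).aestronglyMeasurable, ?_⟩
    rw [eLpNorm_lt_top_iff_lintegral_rpow_enorm_lt_top (by norm_num) (by norm_num)]
    simpa using hfin ψ
  let T : H →ₗ[ℂ] Lp ℂ 2 μ :=
    { toFun := fun ψ => (hL ψ).toLp
      map_add' := fun x y => by
        rw [← MemLp.toLp_add]
        congr 1
        ext q
        simp
      map_smul' := fun c x => by
        rw [RingHom.id_apply, ← MemLp.toLp_const_smul]
        congr 1
        ext q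
        simp }
  have hT : Continuous T := by
    refine T.continuous_of_seq_closed_graph fun u x y hu hTu => ?_
    have h1 : TendstoInMeasure μ (fun n => ((T (u n) : Lp ℂ 2 μ) : Q → ℂ)) atTop y :=
      tendstoInMeasure_of_tendsto_Lp hTu
    obtain ⟨ns, hns, hae⟩ := h1.exists_seq_tendsto_ae
    have h2 : ∀ᵐ q ∂μ, ∀ n, (T (u n) : Lp ℂ 2 μ) q = inner ℂ (e q) (u n) :=
      ae_all_iff.2 fun n => (hL (u n)).coeFn_toLp
    refine Lp.ext ?_
    filter_upwards [hae, h2, (hL x).coeFn_toLp] with q hq hq2 hq3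
    have h3 : Tendsto (fun n => inner ℂ (e q) (u (ns n))) atTop (𝓝 (inner ℂ (e q) x)) :=
      (tendsto_const_nhds.inner (hu.comp hns.tendsto_atTop))
    simp only [hq2] at hq
    rw [tendsto_nhds_unique hq h3]
    exact hq3.symm
  let T' : H →L[ℂ] Lp ℂ 2 μ := ⟨T, hT⟩
  refine ⟨‖T'‖ ^ 2, by positivity, fun ψ => ?_⟩
  have h1 : ‖T' ψ‖ₑ ^ 2 = ∫⁻ q, ‖inner ℂ (e q) ψ‖ₑ ^ 2 ∂μ := by
    have : ‖T' ψ‖ₑ = eLpNorm (fun q => inner ℂ (e q) ψ) 2 μ := Lp.enorm_toLp (hL ψ)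
    rw [this, eLpNorm_eq_lintegral_rpow_enorm_toReal (by norm_num) (by norm_num)]
    simp only [ENNReal.toReal_ofNat, ENNReal.rpow_ofNat, ← ENNReal.rpow_natCast, ← ENNReal.rpow_mul]
    norm_num
  rw [← h1, ← ofReal_norm, ← ENNReal.ofReal_pow (norm_nonneg _), ← mul_pow]
  gcongr
  exact T'.le_opNorm ψ

/-- The Fourier transform is injective on `L¹`. -/
theorem ae_eq_zero_of_fourier_eq_zero {g : ℝ → ℂ} (hg : Integrable g) (h : ∀ ξ, 𝓕 g ξ = 0) :
    ∀ᵐ x, g x = 0 := by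
  refine ae_eq_zero_of_integral_contDiff_smul_eq_zero hg.locallyIntegrable fun φ hφ hc => ?_
  have hφ' : ContDiff ℝ (⊤ : ℕ∞) (fun x => (φ x : ℂ)) := Complex.ofRealCLM.contDiff.comp hφ
  have hc' : HasCompactSupport (fun x => (φ x : ℂ)) := hc.comp_left (g := fun r : ℝ => (r : ℂ)) rfl
  let s : SchwartzMap ℝ ℂ := hc'.toSchwartzMap hφ'
  have hs : 𝓕 (𝓕⁻ s) = s := FourierTransform.fourier_fourierInv_eq s
  have h1 : ∫ ξ, 𝓕 g ξ • (𝓕⁻ s) ξ = ∫ x, g x • 𝓕 (𝓕⁻ s) x := by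
    have h2 := VectorFourier.integral_fourierIntegral_smul_eq_flip (μ := volume) (ν := volume)
      (L := innerₗ ℝ) Real.continuous_fourierChar continuous_inner hg (𝓕⁻ s).integrable
    rw [flip_innerₗ] at h2
    exact h2
  simp only [h, zero_smul, integral_zero, hs] at h1
  rw [h1]
  refine integral_congr_ae (Eventually.of_forall fun x => ?_)
  simp [s, mul_comm]

/-- Cauchy–Schwarz on `(0, ε)` against the weight `1/a`. -/
theorem sq_lintegral_Ioo_le (J : ℝ → ℝ≥0∞) (hJ : Measurable J) {ε : ℝ} (hε : 0 < ε) :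
    (∫⁻ a in Ioo 0 ε, J a) ^ 2
      ≤ ENNReal.ofReal (ε ^ 2) * ∫⁻ a in Ioi 0, J a ^ 2 * ENNReal.ofReal (1 / a) := by
  have h1 := ENNReal.lintegral_mul_le_Lp_mul_Lq (volume.restrict (Ioo 0 ε))
    Real.HolderConjugate.two_two hJ.aemeasurable (aemeasurable_const (b := (1 : ℝ≥0∞)))
  simp only [Pi.mul_apply, mul_one, ENNReal.rpow_ofNat, one_pow, lintegral_const,
    MeasurableSet.univ, Measure.restrict_apply, univ_inter, Real.volume_Ioo, sub_zero, one_mul] at h1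
  have h2 : (∫⁻ a in Ioo 0 ε, J a) ^ 2 ≤ (∫⁻ a in Ioo 0 ε, J a ^ 2) * ENNReal.ofReal ε := by
    calc (∫⁻ a in Ioo 0 ε, J a) ^ 2
        ≤ ((∫⁻ a in Ioo 0 ε, J a ^ 2) ^ (1 / 2 : ℝ) * ENNReal.ofReal ε ^ (1 / 2 : ℝ)) ^ 2 := by
          gcongr
      _ = _ := by
          rw [mul_pow]
          simp only [← ENNReal.rpow_natCast, ← ENNReal.rpow_mul]
          norm_num
  refine h2.trans ?_
  have h3 : ∫⁻ a in Ioo 0 ε, J a ^ 2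
      ≤ ENNReal.ofReal ε * ∫⁻ a in Ioo 0 ε, J a ^ 2 * ENNReal.ofReal (1 / a) := by
    rw [← lintegral_const_mul' _ _ ENNReal.ofReal_ne_top]
    refine setLIntegral_mono' measurableSet_Ioo fun a ha => ?_
    rw [mul_left_comm, ← ENNReal.ofReal_mul hε.le]
    refine le_mul_of_one_le_right zero_le ?_
    rw [ENNReal.one_le_ofReal, mul_one_div, one_le_div ha.1]
    exact ha.2.le
  calc (∫⁻ a in Ioo 0 ε, J a ^ 2) * ENNReal.ofReal ε
      ≤ (ENNReal.ofReal ε * ∫⁻ a in Ioo 0 ε, J a ^ 2 * ENNReal.ofReal (1 / a))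
        * ENNReal.ofReal ε := by gcongr
    _ = ENNReal.ofReal (ε ^ 2) * ∫⁻ a in Ioo 0 ε, J a ^ 2 * ENNReal.ofReal (1 / a) := by
        rw [sq, ENNReal.ofReal_mul hε.le]; ring
    _ ≤ _ := by
        gcongr
        exact Ioo_subset_Ioi_self

end

section

open Filter Topology
open scoped ENNReal NNReal ComplexConjugate

/-- The Fourier coefficient `∫ e^{-2inθ} g(θ) dθ` over the half circle. -/
noncomputable def circleCoeff (g : ℝ → ℂ) (n : ℤ) : ℂ :=
  ∫ θ in arc, Complex.exp (-(2 * n * θ) * Complex.I) * g θ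

theorem integral_arc_eq {E : Type*} [NormedAddCommGroup E] [NormedSpace ℝ E] (g : ℝ → E) :
    ∫ θ in arc, g θ = ∫ θ in (-(Real.pi / 2))..(Real.pi / 2), g θ := by
  rw [intervalIntegral.integral_of_le (by linarith [Real.pi_pos]), integral_Ioc_eq_integral_Ioo]
  rfl

theorem norm_exp_circle (n : ℤ) (θ : ℝ) : ‖Complex.exp (-(2 * n * θ) * Complex.I)‖ = 1 := by
  have := Complex.norm_exp_ofReal_mul_I (-(2 * n * θ))
  push_cast at this
  exact this

theorem lintegral_enorm_sq_eq_tsum {g : ℝ → ℂ} (hg : MemLp g 2 (volume.restrict arc)) :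
    ∫⁻ θ in arc, ‖g θ‖ₑ ^ 2
      = ENNReal.ofReal (1 / Real.pi) * ∑' n : ℤ, ‖circleCoeff g n‖ₑ ^ 2 := by
  have hπ := Real.pi_pos
  have hab : -(Real.pi / 2) < Real.pi / 2 := by linarith
  have hg' : MemLp g 2 (volume.restrict (Ioc (-(Real.pi / 2)) (Real.pi / 2))) := by
    rwa [← restrict_Ioo_eq_restrict_Ioc]
  have h := hasSum_sq_fourierCoeffOn hab hg'
  have hlen : Real.pi / 2 - -(Real.pi / 2) = Real.pi := by ring
  have hc : ∀ n : ℤ, fourierCoeffOn hab g n = ((1 / Real.pi : ℝ) : ℂ) * circleCoeff g n := by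
    intro n
    rw [fourierCoeffOn_eq_integral, circleCoeff, integral_arc_eq, hlen, Complex.real_smul]
    congr 1
    refine intervalIntegral.integral_congr fun x _ => ?_
    simp only [smul_eq_mul]
    congr 1
    rw [fourier_coe_apply]
    congr 1
    push_cast
    field_simp
  simp only [hc, norm_mul, mul_pow, Complex.norm_real, Real.norm_eq_abs, sq_abs, hlen,
    smul_eq_mul, ← integral_arc_eq] at h
  have h1 : HasSum (fun n : ℤ => ‖circleCoeff g n‖ ^ 2) (Real.pi * ∫ θ in arc, ‖g θ‖ ^ 2) := by
    convert! h.mul_left (Real.pi ^ 2) using 1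
    · ext n; field_simp
    · rw [← mul_assoc, sq, mul_assoc Real.pi Real.pi, mul_inv_cancel₀ hπ.ne', mul_one]
  have h2 : ∑' n : ℤ, ‖circleCoeff g n‖ₑ ^ 2
      = ENNReal.ofReal (Real.pi * ∫ θ in arc, ‖g θ‖ ^ 2) := by
    rw [← h1.tsum_eq, ENNReal.ofReal_tsum_of_nonneg (fun n => by positivity) h1.summable]
    refine tsum_congr fun n => ?_
    rw [ENNReal.ofReal_pow (norm_nonneg _), ofReal_norm]
  rw [h2, ← ENNReal.ofReal_mul (by positivity), ← mul_assoc, one_div_mul_cancel hπ.ne', one_mul,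
    ofReal_integral_eq_lintegral_ofReal (hg.integrable_norm_pow (by norm_num))
      (Eventually.of_forall fun θ => by positivity)]
  refine lintegral_congr fun θ => ?_
  rw [ENNReal.ofReal_pow (norm_nonneg _), ofReal_norm]

theorem enorm_signal_sq (ψ : Signal) : ‖ψ‖ₑ ^ 2 = ∫⁻ θ in arc, ‖ψ θ‖ₑ ^ 2 := by
  rw [Lp.enorm_def, eLpNorm_eq_lintegral_rpow_enorm_toReal (by norm_num) (by norm_num)]
  simp only [ENNReal.toReal_ofNat, ENNReal.rpow_ofNat, ← ENNReal.rpow_natCast, ← ENNReal.rpow_mul]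
  norm_num

theorem coeFn_wavelet (γ : Signal) (q : Param) :
    ∀ᵐ θ ∂(volume.restrict arc), wavelet γ q θ = transformFun q.1 q.2 γ θ :=
  (memLp_transformFun q.2.2 (q.1 : ℝ) γ).coeFn_toLp

theorem norm_wavelet (γ : Signal) (q : Param) : ‖wavelet γ q‖ = ‖γ‖ := by
  have h : ‖wavelet γ q‖ₑ ^ 2 = ‖γ‖ₑ ^ 2 := by
    rw [enorm_signal_sq, enorm_signal_sq γ, ← lintegral_transformFun q.2.2 q.1 γ]
    refine lintegral_congr_ae ?_
    filter_upwards [coeFn_wavelet γ q] with θ hθ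
    rw [hθ]
  have h' := congrArg ENNReal.toReal h
  rw [ENNReal.toReal_pow, ENNReal.toReal_pow, toReal_enorm, toReal_enorm] at h'
  exact (pow_left_inj₀ (norm_nonneg _) (norm_nonneg _) two_ne_zero).1 h'

/-- The correlation `∫ conj (P(θ - ϑ)) ψ(θ) dθ`. -/
noncomputable def correlate (P ψ : ℝ → ℂ) (ϑ : ℝ) : ℂ := ∫ θ in arc, conj (P (θ - ϑ)) * ψ θ

theorem transformFun_eq_sub (ϑ a : ℝ) (γ : ℝ → ℂ) (θ : ℝ) :
    transformFun ϑ a γ θ = transformFun 0 a γ (θ - ϑ) := by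
  simp [transformFun]

theorem transformFun_periodic (a : ℝ) (γ : ℝ → ℂ) :
    Function.Periodic (transformFun 0 a γ) Real.pi := by
  intro x
  simp only [transformFun, multiplier, dilate, sub_zero, Real.cos_add_pi, Real.tan_periodic x,
    neg_sq]

theorem inner_wavelet (γ ψ : Signal) (q : Param) :
    inner ℂ (wavelet γ q) ψ = correlate (transformFun 0 q.2 γ) ψ q.1 := by
  rw [L2.inner_def, correlate]
  refine integral_congr_ae ?_
  filter_upwards [coeFn_wavelet γ q] with θ hθ
  rw [hθ, transformFun_eq_sub]
  simp [mul_comm]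

theorem measurable_transformFun_uncurry {γ : ℝ → ℂ} (hγ : StronglyMeasurable γ) :
    StronglyMeasurable fun p : ℝ × ℝ => transformFun 0 p.1 γ p.2 := by
  have h2 : Measurable fun p : ℝ × ℝ => dilate (1 / p.1) (p.2 - 0) := by
    unfold dilate
    exact Real.measurable_arctan.comp ((measurable_const.div measurable_fst).mul
      (measurable_tan.comp (measurable_snd.sub_const 0)))
  have h1 : Measurable fun p : ℝ × ℝ =>
      ((Real.sqrt (multiplier (1 / p.1) (p.2 - 0)) : ℝ) : ℂ) := by
    unfold multiplier
    fun_prop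
  exact h1.stronglyMeasurable.mul (hγ.comp_measurable h2)

theorem measurable_correlate_uncurry {γ ψ : ℝ → ℂ} (hγ : StronglyMeasurable γ)
    (hψ : StronglyMeasurable ψ) :
    Measurable fun p : ℝ × ℝ => correlate (transformFun 0 p.2 γ) ψ p.1 := by
  refine (StronglyMeasurable.integral_prod_right'
    (f := fun p : (ℝ × ℝ) × ℝ => conj (transformFun 0 p.1.2 γ (p.2 - p.1.1)) * ψ p.2) ?_).measurable
  refine StronglyMeasurable.mul ?_ (hψ.comp_measurable measurable_snd)
  exact Complex.continuous_conj.comp_stronglyMeasurable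
    ((measurable_transformFun_uncurry hγ).comp_measurable
      (measurable_fst.snd.prodMk (measurable_snd.sub measurable_fst.fst)))

theorem measurable_correlate {γ ψ : ℝ → ℂ} (hγ : StronglyMeasurable γ)
    (hψ : StronglyMeasurable ψ) (a : ℝ) : Measurable (correlate (transformFun 0 a γ) ψ) := by
  have h1 := measurable_correlate_uncurry hγ hψ
  have h2 : Measurable fun ϑ : ℝ => (ϑ, a) := by fun_prop
  simpa only [Function.comp_def] using h1.comp h2

theorem measurable_correlate_param {γ ψ : ℝ → ℂ} (hγ : StronglyMeasurable γ)
    (hψ : StronglyMeasurable ψ) :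
    Measurable fun q : Param => correlate (transformFun 0 q.2 γ) ψ q.1 := by
  have h1 := measurable_correlate_uncurry hγ hψ
  have h2 : Measurable fun q : Param => ((q.1 : ℝ), (q.2 : ℝ)) := by fun_prop
  simpa only [Function.comp_def] using h1.comp h2

theorem measurable_inner_wavelet (γ ψ : Signal) :
    Measurable fun q : Param => inner ℂ (wavelet γ q) ψ := by
  simp_rw [inner_wavelet]
  exact measurable_correlate_param (Lp.stronglyMeasurable γ) (Lp.stronglyMeasurable ψ)

theorem integral_arc_sub_left {h : ℝ → ℂ} (hp : Function.Periodic h Real.pi) (θ : ℝ) :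
    ∫ ϑ in arc, h (θ - ϑ) = ∫ x in arc, h x := by
  rw [integral_arc_eq, integral_arc_eq, intervalIntegral.integral_comp_sub_left (fun x => h x) θ]
  have h1 := hp.intervalIntegral_add_eq (θ - Real.pi / 2) (-(Real.pi / 2))
  convert h1 using 2 <;> ring

theorem lintegral_arc_sub_left {h : ℝ → ℝ≥0∞} (hp : Function.Periodic h Real.pi) (θ : ℝ) :
    ∫⁻ ϑ in arc, h (θ - ϑ) = ∫⁻ x in arc, h x := by
  have h1 : ∫⁻ ϑ in arc, h (θ - ϑ) = ∫⁻ ϑ in arc, h (-ϑ) := by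
    rw [← lintegral_rotate (fun x => h (-x)) (fun x => ?_) θ]
    · simp
    · simp only [neg_add]
      exact hp.sub_eq (-x)
  have h2 := (Measure.measurePreserving_neg (volume : Measure ℝ)).setLIntegral_comp_preimage_emb
    (MeasurableEquiv.neg ℝ).measurableEmbedding h arc
  have hpre : (Neg.neg ⁻¹' arc : Set ℝ) = arc := by
    ext x
    simp only [arc, mem_preimage, mem_Ioo]
    constructor <;> rintro ⟨h1, h2⟩ <;> constructor <;> linarith
  rw [h1, ← h2, hpre]

theorem circleCoeff_correlate {P ψ : ℝ → ℂ} (hP : Function.Periodic P Real.pi)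
    (hPm : StronglyMeasurable P) (hψm : StronglyMeasurable ψ)
    (hPi : Integrable P (volume.restrict arc)) (hψi : Integrable ψ (volume.restrict arc)) (n : ℤ) :
    circleCoeff (correlate P ψ) n = conj (circleCoeff P n) * circleCoeff ψ n := by
  let F : ℝ → ℝ → ℂ := fun ϑ θ =>
    Complex.exp (-(2 * n * ϑ) * Complex.I) * (conj (P (θ - ϑ)) * ψ θ)
  have hFm : StronglyMeasurable (Function.uncurry F) := by
    refine StronglyMeasurable.mul ?_ (StronglyMeasurable.mul ?_ (hψm.comp_measurable measurable_snd))
    · apply Continuous.stronglyMeasurable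
      fun_prop
    · exact Complex.continuous_conj.comp_stronglyMeasurable
        (hPm.comp_measurable (measurable_snd.sub measurable_fst))
  have hF : Integrable (Function.uncurry F)
      ((volume.restrict arc).prod (volume.restrict arc)) := by
    refine ⟨hFm.aestronglyMeasurable, ?_⟩
    rw [hasFiniteIntegral_iff_enorm, lintegral_prod_symm _ hFm.enorm.aemeasurable]
    have h1 : ∀ θ, ∫⁻ ϑ in arc, ‖Function.uncurry F (ϑ, θ)‖ₑ
        = (∫⁻ x in arc, ‖P x‖ₑ) * ‖ψ θ‖ₑ := by
      intro θ
      rw [← lintegral_arc_sub_left (h := fun x => ‖P x‖ₑ) (fun x => by simp only [hP x]) θ,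
        ← lintegral_mul_const' _ _ enorm_ne_top]
      refine lintegral_congr fun ϑ => ?_
      have : ‖Complex.exp (-(2 * n * ϑ) * Complex.I)‖ₑ = 1 := by
        rw [← ofReal_norm, norm_exp_circle, ENNReal.ofReal_one]
      simp only [Function.uncurry, F, enorm_mul, this, one_mul]
      congr 1
      rw [← ofReal_norm, ← ofReal_norm, RCLike.norm_conj]
    simp only [h1]
    rw [lintegral_const_mul _ hψm.enorm]
    exact ENNReal.mul_lt_top hPi.2 hψi.2
  calc circleCoeff (correlate P ψ) n
      = ∫ ϑ in arc, ∫ θ in arc, F ϑ θ := by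
        simp only [circleCoeff, correlate, F, integral_const_mul]
    _ = ∫ θ in arc, ∫ ϑ in arc, F ϑ θ := integral_integral_swap hF
    _ = ∫ θ in arc, conj (circleCoeff P n) * (Complex.exp (-(2 * n * θ) * Complex.I) * ψ θ) := by
        congr 1
        ext θ
        have hper : Function.Periodic
            (fun x : ℝ => conj (Complex.exp (-(2 * n * x) * Complex.I) * P x)) Real.pi := by
          intro x
          simp only [hP x]
          congr 2
          rw [Complex.exp_eq_exp_iff_exists_int]
          exact ⟨-n, by push_cast; ring⟩
        have h1 : ∀ ϑ : ℝ, F ϑ θ = conj (Complex.exp (-(2 * n * (θ - ϑ : ℝ)) * Complex.I)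
            * P (θ - ϑ)) * (Complex.exp (-(2 * n * θ) * Complex.I) * ψ θ) := by
          intro ϑ
          have h2 : conj (Complex.exp (-(2 * n * (θ - ϑ : ℝ)) * Complex.I))
              * Complex.exp (-(2 * n * θ) * Complex.I) = Complex.exp (-(2 * n * ϑ) * Complex.I) := by
            rw [← Complex.exp_conj, ← Complex.exp_add]
            congr 1
            simp only [map_mul, map_neg, Complex.conj_I, Complex.conj_ofReal, map_ofNat, map_intCast]
            push_cast
            ring
          simp only [F, ← h2, map_mul]
          ring
        simp only [h1]
        rw [integral_mul_const, integral_arc_sub_left hper θ, integral_conj]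
        rfl
    _ = _ := by rw [integral_const_mul]; rfl

/-- The energy `∫ |⟨γ_a | e_n⟩|² da / a²` of the dilates of `γ` in the `n`-th Fourier mode. -/
noncomputable def dilationEnergy (γ : ℝ → ℂ) (n : ℤ) : ℝ≥0∞ :=
  ∫⁻ a in Ioi (0 : ℝ), ‖circleCoeff (transformFun 0 a γ) n‖ₑ ^ 2 * ENNReal.ofReal (1 / a ^ 2)

theorem measurable_circleCoeff_transformFun {γ : ℝ → ℂ} (hγ : StronglyMeasurable γ) (n : ℤ) :
    Measurable fun a => circleCoeff (transformFun 0 a γ) n := by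
  refine (StronglyMeasurable.integral_prod_right' (f := fun p : ℝ × ℝ =>
    Complex.exp (-(2 * n * p.2) * Complex.I) * transformFun 0 p.1 γ p.2) ?_).measurable
  refine StronglyMeasurable.mul ?_ (measurable_transformFun_uncurry hγ)
  apply Continuous.stronglyMeasurable
  fun_prop

theorem lintegral_correlate (γ ψ : Signal) {a : ℝ} (ha : 0 < a) :
    ∫⁻ ϑ in arc, ‖correlate (transformFun 0 a γ) ψ ϑ‖ₑ ^ 2 = ENNReal.ofReal (1 / Real.pi) *
      ∑' n : ℤ, ‖circleCoeff (transformFun 0 a γ) n‖ₑ ^ 2 * ‖circleCoeff ψ n‖ₑ ^ 2 := by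
  have hfin : IsFiniteMeasure (volume.restrict arc) :=
    ⟨by simp [arc, Real.volume_Ioo]⟩
  have hm := measurable_correlate (Lp.stronglyMeasurable γ) (Lp.stronglyMeasurable ψ) a
  have hmem : MemLp (correlate (transformFun 0 a γ) ψ) 2 (volume.restrict arc) := by
    refine MemLp.of_bound hm.aestronglyMeasurable (‖γ‖ * ‖ψ‖) ?_
    filter_upwards [ae_restrict_mem measurableSet_Ioo] with ϑ hϑ
    have h := inner_wavelet γ ψ (⟨ϑ, hϑ⟩, ⟨a, ha⟩)
    rw [← norm_wavelet γ (⟨ϑ, hϑ⟩, ⟨a, ha⟩)]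
    exact h ▸ norm_inner_le_norm _ _
  rw [lintegral_enorm_sq_eq_tsum hmem]
  congr 1
  refine tsum_congr fun n => ?_
  rw [circleCoeff_correlate (transformFun_periodic a γ)
    (stronglyMeasurable_transformFun (Lp.stronglyMeasurable γ) 0 a) (Lp.stronglyMeasurable ψ)
    ((memLp_transformFun ha 0 γ).integrable (by norm_num))
    ((Lp.memLp ψ).integrable (by norm_num)), enorm_mul, mul_pow]
  congr 2
  rw [← ofReal_norm, ← ofReal_norm, RCLike.norm_conj]

theorem lintegral_inner_wavelet (γ ψ : Signal) :
    ∫⁻ q, ‖inner ℂ (wavelet γ q) ψ‖ₑ ^ 2 ∂paramMeasure = ENNReal.ofReal (1 / Real.pi) *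
      ∑' n : ℤ, dilationEnergy γ n * ‖circleCoeff ψ n‖ₑ ^ 2 := by
  have hmeas : Measurable fun p : ℝ × ℝ => correlate (transformFun 0 p.2 γ) ψ p.1 :=
    measurable_correlate_uncurry (Lp.stronglyMeasurable γ) (Lp.stronglyMeasurable ψ)
  have hmeas' : Measurable fun q : Param => ‖inner ℂ (wavelet γ q) ψ‖ₑ ^ 2 :=
    (measurable_inner_wavelet γ ψ).enorm.pow_const 2
  have hs : ∀ s : Set ℝ, MeasurableSet s →
      SigmaFinite (Measure.comap ((↑) : s → ℝ) volume) := by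
    intro s hs
    refine SigmaFinite.of_map _ measurable_subtype_coe.aemeasurable ?_
    rw [map_comap_subtype_coe hs]
    infer_instance
  have hs1 := hs arc measurableSet_Ioo
  have hs2 := hs (Ioi 0) measurableSet_Ioi
  rw [paramMeasure, lintegral_prod_symm _ hmeas'.aemeasurable,
    lintegral_withDensity_eq_lintegral_mul _ (by fun_prop) hmeas'.lintegral_prod_left']
  simp only [Pi.mul_apply, inner_wavelet]
  have h1 : ∀ a : Ioi (0 : ℝ), ∫⁻ ϑ : arc, ‖correlate (transformFun 0 a γ) ψ ϑ‖ₑ ^ 2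
      ∂(Measure.comap ((↑) : arc → ℝ) volume) = ENNReal.ofReal (1 / Real.pi) *
      ∑' n : ℤ, ‖circleCoeff (transformFun 0 a γ) n‖ₑ ^ 2 * ‖circleCoeff ψ n‖ₑ ^ 2 := by
    intro a
    rw [lintegral_subtype_comap (show MeasurableSet arc from measurableSet_Ioo)
      (fun ϑ => ‖correlate (transformFun 0 a γ) ψ ϑ‖ₑ ^ 2)]
    exact lintegral_correlate γ ψ a.2
  simp only [h1]
  rw [lintegral_subtype_comap measurableSet_Ioi (fun a : ℝ => ENNReal.ofReal (1 / a ^ 2) *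
    (ENNReal.ofReal (1 / Real.pi) * ∑' n : ℤ, ‖circleCoeff (transformFun 0 a γ) n‖ₑ ^ 2
      * ‖circleCoeff ψ n‖ₑ ^ 2))]
  have hc := fun n => measurable_circleCoeff_transformFun (Lp.stronglyMeasurable γ) n
  simp only [dilationEnergy]
  simp_rw [mul_left_comm (ENNReal.ofReal (1 / _ ^ 2)) (ENNReal.ofReal (1 / Real.pi))]
  rw [lintegral_const_mul' _ _ ENNReal.ofReal_ne_top]
  congr 1
  simp_rw [← ENNReal.tsum_mul_left]
  rw [lintegral_tsum (fun n => by have := hc n; fun_prop)]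
  refine tsum_congr fun n => ?_
  rw [← lintegral_mul_const' _ _ (by simp)]
  refine lintegral_congr fun a => ?_
  ring

end

section

open Filter Topology
open scoped ENNReal NNReal ComplexConjugate

/-- The function on the line corresponding to `γ` under `y = tan θ`. -/
noncomputable def lineFun (γ : ℝ → ℂ) (y : ℝ) : ℂ :=
  ((Real.sqrt (1 + y ^ 2))⁻¹ : ℝ) * γ (Real.arctan y)

/-- The even Fourier mode `cos (2νθ)` in the coordinate `t = tan θ`. -/
noncomputable def modeKernel (ν t : ℝ) : ℝ :=
  Real.cos (2 * ν * Real.arctan t) * (Real.sqrt (1 + t ^ 2))⁻¹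

/-- The pairing of the dilates of `f` with the mode `ν`. -/
noncomputable def modePairing (f : ℝ → ℂ) (ν a : ℝ) : ℂ := ∫ x, f x * modeKernel ν (a * x)

theorem continuous_inv_sqrt_one_add_sq : Continuous fun t : ℝ => (Real.sqrt (1 + t ^ 2))⁻¹ :=
  Continuous.inv₀ (by fun_prop) fun t => (Real.sqrt_pos.2 (by positivity)).ne'

@[fun_prop]
theorem continuous_modeKernel (ν : ℝ) : Continuous (modeKernel ν) := by
  have h := continuous_inv_sqrt_one_add_sq
  have h2 := Real.continuous_arctan
  unfold modeKernel
  exact (by fun_prop : Continuous fun t => Real.cos (2 * ν * Real.arctan t)).mul h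

theorem abs_modeKernel_le (ν t : ℝ) : |modeKernel ν t| ≤ (Real.sqrt (1 + t ^ 2))⁻¹ := by
  rw [modeKernel, abs_mul, abs_of_nonneg (a := (Real.sqrt (1 + t ^ 2))⁻¹) (by positivity)]
  exact mul_le_of_le_one_left (by positivity) (Real.abs_cos_le_one _)

theorem modeKernel_neg (ν t : ℝ) : modeKernel (-ν) t = modeKernel ν t := by
  unfold modeKernel
  congr 1
  rw [← Real.cos_neg]
  ring_nf

theorem modeKernel_apply_neg (ν t : ℝ) : modeKernel ν (-t) = modeKernel ν t := by
  unfold modeKernel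
  rw [Real.arctan_neg, neg_sq, mul_neg, Real.cos_neg]

theorem modePairing_neg (f : ℝ → ℂ) (ν a : ℝ) : modePairing f (-ν) a = modePairing f ν a := by
  simp only [modePairing, modeKernel_neg]

theorem inv_sqrt_le {a : ℝ} (ha : 0 < a) (x : ℝ) :
    (Real.sqrt (1 + (a * x) ^ 2))⁻¹ ≤ (1 + 1 / a) * (1 + |x|) ^ (-(3 / 4) : ℝ) := by
  have h1 : 1 ≤ Real.sqrt (1 + (a * x) ^ 2) := by
    rw [Real.one_le_sqrt]; nlinarith [sq_nonneg (a * x)]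
  have h2 : a * |x| ≤ Real.sqrt (1 + (a * x) ^ 2) := by
    apply Real.le_sqrt_of_sq_le
    rw [mul_pow, sq_abs, mul_pow]
    linarith
  have h3 : 1 + |x| ≤ (1 + 1 / a) * Real.sqrt (1 + (a * x) ^ 2) := by
    have : |x| ≤ 1 / a * Real.sqrt (1 + (a * x) ^ 2) := by
      rw [one_div, inv_mul_eq_div, le_div_iff₀ ha]; linarith
    linarith
  have h4 : (1 + |x|) ^ (3 / 4 : ℝ) ≤ 1 + |x| := by
    conv_rhs => rw [← Real.rpow_one (1 + |x|)]
    exact Real.rpow_le_rpow_of_exponent_le (by linarith [abs_nonneg x]) (by norm_num)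
  rw [Real.rpow_neg (by positivity), ← div_eq_mul_inv, le_div_iff₀ (by positivity), inv_mul_le_iff₀
    (by positivity)]
  linarith

theorem memLp_of_abs_le {k : ℝ → ℝ} (hk : AEStronglyMeasurable k) {B : ℝ}
    (h : ∀ x, |k x| ≤ B * (1 + |x|) ^ (-(3 / 4) : ℝ)) : MemLp k 2 := by
  rw [memLp_two_iff_integrable_sq hk]
  have h0 : Integrable fun x : ℝ => B ^ 2 * (1 + |x|) ^ (-(3 / 2) : ℝ) := by
    refine Integrable.const_mul ?_ _
    have := integrable_one_add_norm (E := ℝ) (μ := volume) (r := 3 / 2) (by simp; norm_num)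
    simpa using this
  refine h0.mono' (hk.pow 2) (Eventually.of_forall fun x => ?_)
  rw [Real.norm_eq_abs, abs_pow]
  calc |k x| ^ 2 ≤ (B * (1 + |x|) ^ (-(3 / 4) : ℝ)) ^ 2 := by
        gcongr; exact h x
    _ = _ := by
        rw [mul_pow, ← Real.rpow_natCast ((1 + |x|) ^ (-(3 / 4) : ℝ)) 2, ← Real.rpow_mul
          (by positivity)]
        norm_num

theorem integrable_mul_of_abs_le {f : ℝ → ℂ} (hf : MemLp f 2) {k : ℝ → ℝ}
    (hk : AEStronglyMeasurable k) {B : ℝ} (h : ∀ x, |k x| ≤ B * (1 + |x|) ^ (-(3 / 4) : ℝ)) :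
    Integrable fun x => f x * k x :=
  hf.integrable_mul (memLp_of_abs_le hk h).ofReal

theorem integrable_mul_modeKernel {f : ℝ → ℂ} (hf : MemLp f 2) (ν : ℝ) {a : ℝ} (ha : 0 < a) :
    Integrable fun x => f x * modeKernel ν (a * x) := by
  refine integrable_mul_of_abs_le hf (k := fun x => modeKernel ν (a * x)) (B := 1 + 1 / a)
    (by fun_prop) fun x => ?_
  exact (abs_modeKernel_le _ _).trans (inv_sqrt_le ha x)

theorem lintegral_arc_eq_lintegral_arctan (g : ℝ → ℝ≥0∞) :
    ∫⁻ θ in arc, g θ = ∫⁻ y, ENNReal.ofReal (1 / (1 + y ^ 2)) * g (Real.arctan y) := by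
  have h := lintegral_image_eq_lintegral_abs_deriv_mul (s := univ) (f := Real.arctan)
    (f' := fun y => 1 / (1 + y ^ 2)) MeasurableSet.univ
    (fun x _ => (Real.hasDerivAt_arctan x).hasDerivWithinAt) Real.arctan_injective.injOn g
  rw [image_univ, Real.range_arctan, Measure.restrict_univ] at h
  rw [arc, h]
  refine lintegral_congr fun y => ?_
  rw [abs_of_nonneg (by positivity)]

theorem integral_arc_eq_integral_arctan (g : ℝ → ℂ) :
    ∫ θ in arc, g θ = ∫ y, ((1 / (1 + y ^ 2) : ℝ) : ℂ) * g (Real.arctan y) := by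
  have h := integral_image_eq_integral_abs_deriv_smul (s := univ) (f := Real.arctan)
    (f' := fun y => 1 / (1 + y ^ 2)) MeasurableSet.univ
    (fun x _ => (Real.hasDerivAt_arctan x).hasDerivWithinAt) Real.arctan_injective.injOn g
  rw [image_univ, Real.range_arctan, Measure.restrict_univ] at h
  rw [arc, h]
  refine integral_congr_ae (Eventually.of_forall fun y => ?_)
  simp only
  rw [abs_of_nonneg (by positivity), Complex.real_smul]

theorem ae_arctan_of_ae_arc {p : ℝ → Prop} (h : ∀ᵐ θ ∂(volume.restrict arc), p θ) :
    ∀ᵐ y, p (Real.arctan y) := by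
  rw [ae_restrict_iff' (show MeasurableSet arc from measurableSet_Ioo), ae_iff] at h
  have hd : DifferentiableOn ℝ Real.tan {θ | ¬(θ ∈ arc → p θ)} := by
    intro x hx
    simp only [mem_ofPred_eq, Classical.not_imp] at hx
    exact (Real.hasDerivAt_tan_of_mem_Ioo hx.1).differentiableAt.differentiableWithinAt
  have h2 := addHaar_image_eq_zero_of_differentiableOn_of_addHaar_eq_zero volume hd h
  rw [ae_iff]
  refine measure_mono_null (fun y hy => ?_) h2
  exact ⟨Real.arctan y, fun hp => hy (hp (Real.arctan_mem_Ioo y)), Real.tan_arctan y⟩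

theorem memLp_lineFun (γ : Signal) : MemLp (lineFun γ) 2 := by
  have hm : StronglyMeasurable (lineFun γ) := by
    refine StronglyMeasurable.mul ?_
      ((Lp.stronglyMeasurable γ).comp_measurable Real.measurable_arctan)
    exact (Complex.continuous_ofReal.comp continuous_inv_sqrt_one_add_sq).stronglyMeasurable
  refine ⟨hm.aestronglyMeasurable, ?_⟩
  have h := (Lp.memLp γ).2
  rw [eLpNorm_lt_top_iff_lintegral_rpow_enorm_lt_top (by norm_num) (by norm_num)] at h ⊢
  simp only [ENNReal.toReal_ofNat, ENNReal.rpow_ofNat] at h ⊢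
  rw [lintegral_arc_eq_lintegral_arctan] at h
  refine lt_of_eq_of_lt (lintegral_congr fun y => ?_) h
  rw [lineFun, enorm_mul, mul_pow]
  congr 1
  rw [← ofReal_norm, Complex.norm_real, Real.norm_of_nonneg (by positivity),
    ← ENNReal.ofReal_pow (by positivity), inv_pow, Real.sq_sqrt (by positivity), one_div]

theorem lineFun_even {γ : Signal} (h : IsEven γ) : ∀ᵐ y, lineFun γ (-y) = lineFun γ y := by
  filter_upwards [ae_arctan_of_ae_arc h] with y hy
  rw [lineFun, lineFun, Real.arctan_neg, hy, neg_sq]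

theorem transformFun_arctan {a : ℝ} (ha : 0 < a) (γ : ℝ → ℂ) (x : ℝ) :
    (a * (1 / (1 + (a * x) ^ 2)) : ℝ) * transformFun 0 a γ (Real.arctan (a * x))
      = (Real.sqrt a * (Real.sqrt (1 + (a * x) ^ 2))⁻¹ : ℝ) * lineFun γ x := by
  have hx : (1 / a) * (a * x) = x := by field_simp
  simp only [transformFun, dilate, sub_zero, Real.tan_arctan, hx, lineFun]
  have hm : multiplier (1 / a) (Real.arctan (a * x)) = (1 + (a * x) ^ 2) / (a * (1 + x ^ 2)) := by
    rw [multiplier, Real.cos_sq_arctan]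
    have h1 : (0 : ℝ) < 1 + (a * x) ^ 2 := by positivity
    have h2 : (0 : ℝ) < 1 + x ^ 2 := by positivity
    have h3 : (1 / a) ^ 2 + (1 - (1 / a) ^ 2) * (1 / (1 + (a * x) ^ 2))
        = (1 + x ^ 2) / (1 + (a * x) ^ 2) := by
      field_simp
      ring
    rw [h3]
    field_simp
  rw [hm, Real.sqrt_div (by positivity), Real.sqrt_mul ha.le, ← mul_assoc, ← mul_assoc,
    ← Complex.ofReal_mul, ← Complex.ofReal_mul]
  congr 2
  have h1 : 0 < Real.sqrt (1 + (a * x) ^ 2) := Real.sqrt_pos.2 (by positivity)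
  have h2 : 0 < Real.sqrt (1 + x ^ 2) := Real.sqrt_pos.2 (by positivity)
  have h3 : 0 < Real.sqrt a := Real.sqrt_pos.2 ha
  have e1 : 1 + (a * x) ^ 2 = Real.sqrt (1 + (a * x) ^ 2) ^ 2 := (Real.sq_sqrt (by positivity)).symm
  have e2 : a = Real.sqrt a ^ 2 := (Real.sq_sqrt ha.le).symm
  calc a * (1 / (1 + (a * x) ^ 2)) *
        (Real.sqrt (1 + (a * x) ^ 2) / (Real.sqrt a * Real.sqrt (1 + x ^ 2)))
      = Real.sqrt a ^ 2 * (1 / Real.sqrt (1 + (a * x) ^ 2) ^ 2) *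
        (Real.sqrt (1 + (a * x) ^ 2) / (Real.sqrt a * Real.sqrt (1 + x ^ 2))) := by
        rw [← e1, ← e2]
    _ = _ := by field_simp

theorem circleCoeff_transformFun {γ : Signal} (heven : IsEven γ) (n : ℤ) {a : ℝ} (ha : 0 < a) :
    circleCoeff (transformFun 0 a γ) n = (Real.sqrt a : ℂ) * modePairing (lineFun γ) n a := by
  have hf := memLp_lineFun γ
  let S : ℝ → ℝ := fun x =>
    Real.sin (2 * n * Real.arctan (a * x)) * (Real.sqrt (1 + (a * x) ^ 2))⁻¹
  have hS : Integrable fun x => lineFun γ x * S x := by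
    refine integrable_mul_of_abs_le hf (B := 1 + 1 / a) ?_ fun x => ?_
    · have h := continuous_inv_sqrt_one_add_sq
      have h2 := Real.continuous_arctan
      exact ((by fun_prop : Continuous fun x => Real.sin (2 * n * Real.arctan (a * x))).mul
        (h.comp (continuous_const_mul a))).aestronglyMeasurable
    · refine le_trans ?_ (inv_sqrt_le ha x)
      simp only [S]
      rw [abs_mul, abs_of_nonneg (a := (Real.sqrt (1 + (a * x) ^ 2))⁻¹) (by positivity)]
      exact mul_le_of_le_one_left (by positivity) (Real.abs_sin_le_one _)
  have hS0 : ∫ x, lineFun γ x * S x = 0 := by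
    have h1 : ∫ x, lineFun γ x * S x = ∫ x, -(lineFun γ x * S x) := by
      rw [← integral_neg_eq_self]
      refine integral_congr_ae ?_
      filter_upwards [lineFun_even heven] with x hx
      have : S (-x) = -S x := by simp [S]
      rw [hx, this]
      push_cast
      ring
    rw [integral_neg] at h1
    exact self_eq_neg.1 h1
  have hsc := Measure.integral_comp_mul_left (fun y => ((1 / (1 + y ^ 2) : ℝ) : ℂ) *
    (Complex.exp (-(2 * n * (Real.arctan y : ℝ)) * Complex.I)
      * transformFun 0 a γ (Real.arctan y))) a
  rw [circleCoeff, integral_arc_eq_integral_arctan]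
  rw [abs_of_pos (inv_pos.2 ha), Complex.real_smul] at hsc
  have hsc' := congrArg (fun z => (a : ℂ) * z) hsc
  beta_reduce at hsc'
  rw [← mul_assoc, ← Complex.ofReal_mul, mul_inv_cancel₀ ha.ne', Complex.ofReal_one, one_mul]
    at hsc'
  rw [← hsc', ← integral_const_mul]
  have h2 : ∀ x : ℝ, (a : ℂ) * (((1 / (1 + (a * x) ^ 2) : ℝ) : ℂ) *
    (Complex.exp (-(2 * n * (Real.arctan (a * x) : ℝ)) * Complex.I)
      * transformFun 0 a γ (Real.arctan (a * x)))) = (Real.sqrt a : ℂ) *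
      (lineFun γ x * modeKernel n (a * x) - Complex.I * (lineFun γ x * S x)) := by
    intro x
    have h3 := transformFun_arctan ha γ x
    have h4 : Complex.exp (-(2 * n * (Real.arctan (a * x) : ℝ)) * Complex.I)
        = Real.cos (2 * n * Real.arctan (a * x))
          - Real.sin (2 * n * Real.arctan (a * x)) * Complex.I := by
      rw [Complex.exp_mul_I, Complex.cos_neg, Complex.sin_neg]
      push_cast
      ring
    calc _ = Complex.exp (-(2 * n * (Real.arctan (a * x) : ℝ)) * Complex.I) *
          ((a * (1 / (1 + (a * x) ^ 2)) : ℝ) * transformFun 0 a γ (Real.arctan (a * x))) := by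
          push_cast; ring
      _ = _ := by
          rw [h3, h4]
          simp only [modeKernel, S]
          push_cast
          ring
  simp only [h2]
  rw [integral_const_mul, integral_sub (integrable_mul_modeKernel hf n ha) (hS.const_mul _),
    integral_const_mul, hS0, mul_zero, sub_zero]
  rfl

theorem dilationEnergy_eq {γ : Signal} (heven : IsEven γ) (n : ℤ) :
    dilationEnergy γ n
      = ∫⁻ a in Ioi (0 : ℝ), ‖modePairing (lineFun γ) n a‖ₑ ^ 2 * ENNReal.ofReal (1 / a) := by
  refine setLIntegral_congr_fun measurableSet_Ioi fun a (ha : 0 < a) => ?_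
  rw [circleCoeff_transformFun heven n ha, enorm_mul, mul_pow, ← ofReal_norm, Complex.norm_real,
    Real.norm_of_nonneg (by positivity), ← ENNReal.ofReal_pow (by positivity),
    Real.sq_sqrt ha.le, mul_comm (ENNReal.ofReal a), mul_assoc, ← ENNReal.ofReal_mul ha.le]
  congr 2
  field_simp

end

section

open Filter Topology Polynomial
open scoped ENNReal NNReal ComplexConjugate

section ExponentialFree

variable {V : Submodule ℂ (ℝ → ℂ)}

/-- Differentiation on a space of functions that is stable under it. -/
noncomputable def derivOn (V : Submodule ℂ (ℝ → ℂ)) (hd : ∀ v ∈ V, Differentiable ℝ v)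
    (hV : ∀ v ∈ V, deriv v ∈ V) : Module.End ℂ V where
  toFun v := ⟨deriv v, hV v v.2⟩
  map_add' v w := by
    ext u
    exact deriv_add (hd v v.2 u) (hd w w.2 u)
  map_smul' c v := by
    ext u
    exact deriv_const_smul c (hd v v.2 u)

theorem eq_zero_of_deriv_eq_mul {v : ℝ → ℂ} (hd : Differentiable ℝ v) (h1 : Tendsto v atTop (𝓝 0))
    (h2 : Tendsto v atBot (𝓝 0)) {μ : ℂ} (h : ∀ u, deriv v u = μ * v u) : v = 0 := by
  have hexp : ∀ u : ℝ, HasDerivAt (fun u : ℝ => Complex.exp (-μ * u)) (-μ * Complex.exp (-μ * u)) u :=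
    fun u => by
      have h3 : HasDerivAt (fun u : ℝ => -μ * (u : ℂ)) (-μ) u := by
        simpa using (Complex.ofRealCLM.hasDerivAt (x := u)).const_mul (-μ)
      simpa [mul_comm] using h3.cexp
  have hc : ∀ u, v u * Complex.exp (-μ * u) = v 0 := by
    intro u
    have h3 : ∀ u, HasDerivAt (fun u : ℝ => v u * Complex.exp (-μ * u)) 0 u := fun u => by
      refine ((hd u).hasDerivAt.mul (hexp u)).congr_deriv ?_
      rw [h u]
      ring
    have h4 := is_const_of_deriv_eq_zero (fun u => (h3 u).differentiableAt)
      (fun u => (h3 u).deriv) u 0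
    simpa using h4
  have hn : ∀ u, ‖v u‖ = ‖v 0‖ * Real.exp (μ.re * u) := by
    intro u
    rw [← hc u, norm_mul, Complex.norm_exp, mul_assoc, ← Real.exp_add]
    simp
  have h0 : v 0 = 0 := by
    have key : ∀ l : Filter ℝ, l.NeBot → Tendsto v l (𝓝 0) → (∀ᶠ u in l, 0 ≤ μ.re * u) → v 0 = 0 := by
      intro l hl ht hpos
      have h3 : ‖v 0‖ ≤ ‖(0 : ℂ)‖ := by
        refine ge_of_tendsto ht.norm ?_
        filter_upwards [hpos] with u hu
        rw [hn u]
        exact le_mul_of_one_le_right (norm_nonneg _) (Real.one_le_exp hu)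
      simpa using h3
    rcases le_total 0 μ.re with hμ | hμ
    · exact key atTop inferInstance h1
        ((eventually_ge_atTop 0).mono fun u hu => mul_nonneg hμ hu)
    · exact key atBot inferInstance h2
        ((eventually_le_atBot 0).mono fun u hu => mul_nonneg_of_nonpos_of_nonpos hμ hu)
  ext u
  have := hn u
  simpa [h0] using this

/-- Constant coefficient differential operators are injective on functions vanishing at both
ends. -/
theorem aeval_derivOn_injective (hd : ∀ v ∈ V, Differentiable ℝ v) (hV : ∀ v ∈ V, deriv v ∈ V)
    (h1 : ∀ v ∈ V, Tendsto v atTop (𝓝 0)) (h2 : ∀ v ∈ V, Tendsto v atBot (𝓝 0))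
    (n : ℕ) : ∀ P : ℂ[X], P ≠ 0 → P.natDegree = n → ∀ v : V, aeval (derivOn V hd hV) P v = 0 →
      v = 0 := by
  induction n with
  | zero =>
    intro P hP hn v hv
    rw [eq_C_of_natDegree_eq_zero hn] at hv hP
    rw [aeval_C, Module.algebraMap_end_apply] at hv
    exact (smul_eq_zero.1 hv).resolve_left (by simpa using hP)
  | succ n ih =>
    intro P hP hn v hv
    obtain ⟨μ, hμ⟩ := IsAlgClosed.exists_root P
      (by rw [degree_eq_natDegree hP, hn]; exact_mod_cast n.succ_ne_zero)
    obtain ⟨Q, rfl⟩ := dvd_iff_isRoot.2 hμ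
    have hQ : Q ≠ 0 := right_ne_zero_of_mul hP
    have hQn : Q.natDegree = n := by
      rw [natDegree_mul (X_sub_C_ne_zero μ) hQ, natDegree_X_sub_C] at hn
      omega
    refine ih Q hQ hQn v ?_
    set w := aeval (derivOn V hd hV) Q v with hw
    rw [map_mul, Module.End.mul_apply, ← hw, map_sub, aeval_X, aeval_C, LinearMap.sub_apply,
      Module.algebraMap_end_apply, sub_eq_zero] at hv
    have h3 : (w : ℝ → ℂ) = 0 := by
      refine eq_zero_of_deriv_eq_mul (hd w w.2) (h1 w w.2) (h2 w w.2) (μ := μ) fun u => ?_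
      exact congrFun (congrArg Subtype.val hv) u
    exact Subtype.ext h3

end ExponentialFree

/-- The pairing with the mode `ν`, normalized and in the logarithmic dilation variable. -/
noncomputable def logPairing (f : ℝ → ℂ) (ν u : ℝ) : ℂ :=
  ∫ x, f x * (Real.exp (u / 2) * modeKernel ν (Real.exp u * x) : ℝ)

theorem logPairing_eq (f : ℝ → ℂ) (ν u : ℝ) :
    logPairing f ν u = Real.exp (u / 2) * modePairing f ν (Real.exp u) := by
  rw [logPairing, modePairing, ← integral_const_mul]
  congr 1
  ext x
  push_cast
  ring

theorem hasDerivAt_modeKernel (ν t : ℝ) : HasDerivAt (modeKernel ν)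
    (-Real.sin (2 * ν * Real.arctan t) * (2 * ν * (1 / (1 + t ^ 2))) * (Real.sqrt (1 + t ^ 2))⁻¹
      + Real.cos (2 * ν * Real.arctan t) * (-(t / Real.sqrt (1 + t ^ 2)) / Real.sqrt (1 + t ^ 2) ^ 2))
    t := by
  have hpos : (0 : ℝ) < 1 + t ^ 2 := by positivity
  have h1 : HasDerivAt (fun t => Real.cos (2 * ν * Real.arctan t))
      (-Real.sin (2 * ν * Real.arctan t) * (2 * ν * (1 / (1 + t ^ 2)))) t :=
    ((Real.hasDerivAt_arctan t).const_mul (2 * ν)).cos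
  have h2 : HasDerivAt (fun t : ℝ => Real.sqrt (1 + t ^ 2)) (t / Real.sqrt (1 + t ^ 2)) t := by
    have h3 : HasDerivAt (fun t : ℝ => 1 + t ^ 2) (2 * t) t := by
      simpa using (hasDerivAt_pow 2 t).const_add 1
    refine (h3.sqrt hpos.ne').congr_deriv ?_
    field_simp
  exact h1.mul (h2.inv (Real.sqrt_pos.2 hpos).ne')

theorem modeKernel_recurrence (ν t : ℝ) :
    modeKernel ν t / 2 + t *
      (-Real.sin (2 * ν * Real.arctan t) * (2 * ν * (1 / (1 + t ^ 2))) * (Real.sqrt (1 + t ^ 2))⁻¹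
      + Real.cos (2 * ν * Real.arctan t) * (-(t / Real.sqrt (1 + t ^ 2)) / Real.sqrt (1 + t ^ 2) ^ 2))
    = (ν / 2 + 1 / 4) * modeKernel (ν + 1) t - (ν / 2 - 1 / 4) * modeKernel (ν - 1) t := by
  have hpos : (0 : ℝ) < 1 + t ^ 2 := by positivity
  have hs : Real.sqrt (1 + t ^ 2) ^ 2 = 1 + t ^ 2 := Real.sq_sqrt hpos.le
  have hs0 : Real.sqrt (1 + t ^ 2) ≠ 0 := (Real.sqrt_pos.2 hpos).ne'
  have hc2 : Real.cos (2 * Real.arctan t) = (1 - t ^ 2) / (1 + t ^ 2) := by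
    rw [Real.cos_two_mul, Real.cos_sq_arctan]
    field_simp
    ring
  have hs2 : Real.sin (2 * Real.arctan t) = 2 * t / (1 + t ^ 2) := by
    rw [Real.sin_two_mul, Real.sin_arctan, Real.cos_arctan]
    conv_rhs => rw [← hs]
    generalize Real.sqrt (1 + t ^ 2) = s at hs0
    field_simp
  have e1 : 2 * (ν + 1) * Real.arctan t = 2 * ν * Real.arctan t + 2 * Real.arctan t := by ring
  have e2 : 2 * (ν - 1) * Real.arctan t = 2 * ν * Real.arctan t - 2 * Real.arctan t := by ring
  unfold modeKernel
  rw [e1, e2, Real.cos_add, Real.cos_sub, hc2, hs2, hs]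
  field_simp
  ring

theorem hasDerivAt_log_modeKernel (ν x u : ℝ) :
    HasDerivAt (fun u => Real.exp (u / 2) * modeKernel ν (Real.exp u * x))
      (Real.exp (u / 2) * ((ν / 2 + 1 / 4) * modeKernel (ν + 1) (Real.exp u * x)
        - (ν / 2 - 1 / 4) * modeKernel (ν - 1) (Real.exp u * x))) u := by
  rw [← modeKernel_recurrence]
  have h1 : HasDerivAt (fun u : ℝ => Real.exp (u / 2)) (Real.exp (u / 2) * (1 / 2)) u :=
    ((hasDerivAt_id u).div_const 2).exp
  have h2 : HasDerivAt (fun u : ℝ => Real.exp u * x) (Real.exp u * x) u :=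
    (Real.hasDerivAt_exp u).mul_const x
  refine (h1.mul ((hasDerivAt_modeKernel ν (Real.exp u * x)).comp u h2)).congr_deriv ?_
  simp only [Function.comp_apply]
  ring

theorem hasDerivAt_logPairing {f : ℝ → ℂ} (hf : MemLp f 2) (ν u : ℝ) :
    HasDerivAt (logPairing f ν) ((ν / 2 + 1 / 4 : ℝ) * logPairing f (ν + 1) u
      - (ν / 2 - 1 / 4 : ℝ) * logPairing f (ν - 1) u) u := by
  have hint : ∀ ν u : ℝ, Integrable fun x =>
      f x * (Real.exp (u / 2) * modeKernel ν (Real.exp u * x) : ℝ) := by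
    intro ν u
    convert! (integrable_mul_modeKernel hf ν (Real.exp_pos u)).const_mul (Real.exp (u / 2) : ℂ)
      using 2
    push_cast
    ring
  let K : ℝ → ℝ → ℝ := fun u x => Real.exp (u / 2) * ((ν / 2 + 1 / 4) *
    modeKernel (ν + 1) (Real.exp u * x) - (ν / 2 - 1 / 4) * modeKernel (ν - 1) (Real.exp u * x))
  let A : ℝ := Real.exp ((u + 1) / 2) * (|ν / 2 + 1 / 4| + |ν / 2 - 1 / 4|)
  have hK : ∀ v ∈ Metric.ball u 1, ∀ x, |K v x|
      ≤ A * (Real.sqrt (1 + (Real.exp (u - 1) * x) ^ 2))⁻¹ := by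
    intro v hv x
    rw [Metric.mem_ball, Real.dist_eq, abs_lt] at hv
    have hm : ∀ ν', |modeKernel ν' (Real.exp v * x)|
        ≤ (Real.sqrt (1 + (Real.exp (u - 1) * x) ^ 2))⁻¹ := by
      intro ν'
      refine (abs_modeKernel_le _ _).trans ?_
      have : 0 < Real.sqrt (1 + (Real.exp (u - 1) * x) ^ 2) := Real.sqrt_pos.2 (by positivity)
      rw [mul_pow, mul_pow]
      rw [mul_pow] at this
      gcongr
      linarith
    simp only [K, A]
    rw [abs_mul, Real.abs_exp, mul_assoc]
    have h1 : Real.exp (v / 2) ≤ Real.exp ((u + 1) / 2) := by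
      gcongr; linarith
    refine mul_le_mul h1 ?_ (abs_nonneg _) (Real.exp_pos _).le
    refine (abs_sub _ _).trans ?_
    rw [abs_mul, abs_mul, add_mul]
    gcongr
    · exact hm _
    · exact hm _
  have hres := hasDerivAt_integral_of_dominated_loc_of_deriv_le (μ := volume)
    (F := fun u x => f x * (Real.exp (u / 2) * modeKernel ν (Real.exp u * x) : ℝ))
    (F' := fun u x => f x * (K u x : ℝ)) (x₀ := u) (s := Metric.ball u 1)
    (bound := fun x => ‖f x * (A * (Real.sqrt (1 + (Real.exp (u - 1) * x) ^ 2))⁻¹ : ℝ)‖)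
    (Metric.ball_mem_nhds u one_pos)
    (Eventually.of_forall fun v => (hint ν v).1) (hint ν u)
    (hf.1.mul (Complex.continuous_ofReal.comp (by fun_prop)).aestronglyMeasurable)
    (Eventually.of_forall fun x v hv => ?_) ?_ (Eventually.of_forall fun x v _ => ?_)
  · refine hres.2.congr_deriv ?_
    simp only [logPairing]
    rw [← integral_const_mul, ← integral_const_mul,
      ← integral_sub ((hint _ _).const_mul _) ((hint _ _).const_mul _)]
    congr 1
    ext x
    simp only [K]
    push_cast
    ring
  · rw [norm_mul, norm_mul, Complex.norm_real, Complex.norm_real, Real.norm_eq_abs]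
    gcongr
    exact (hK v hv x).trans (le_abs_self _)
  · refine (integrable_mul_of_abs_le hf (B := |A| * (1 + 1 / Real.exp (u - 1))) ?_ fun x => ?_).norm
    · exact (continuous_const.mul (continuous_inv_sqrt_one_add_sq.comp
        (continuous_const_mul _))).aestronglyMeasurable
    · rw [abs_mul, mul_assoc, abs_of_nonneg (a := (Real.sqrt _)⁻¹) (by positivity)]
      gcongr
      exact inv_sqrt_le (Real.exp_pos _) x
  · exact ((hasDerivAt_log_modeKernel ν x v).ofReal_comp).const_mul (f x)

theorem tendsto_logPairing {f : ℝ → ℂ} (hf : MemLp f 2) (ν : ℝ) {l : Filter ℝ}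
    [l.IsCountablyGenerated] (hl : ∀ x : ℝ, x ≠ 0 → Tendsto (fun u => Real.exp (u / 2) *
      (Real.sqrt (1 + (Real.exp u * x) ^ 2))⁻¹) l (𝓝 0)) :
    Tendsto (logPairing f ν) l (𝓝 0) := by
  refine tendsto_integral_mul_of_sq_bounded hf
    (k := fun u x => Real.exp (u / 2) * modeKernel ν (Real.exp u * x)) (fun u => ?_)
    (M := ENNReal.ofReal Real.pi) ENNReal.ofReal_ne_top (Eventually.of_forall fun u => ?_) ?_
  · exact Continuous.measurable (by fun_prop)
  · have h1 : ∫ x, Real.exp u * (1 + (Real.exp u * x) ^ 2)⁻¹ = Real.pi := by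
      rw [integral_const_mul, Measure.integral_comp_mul_left (fun x : ℝ => (1 + x ^ 2)⁻¹),
        integral_univ_inv_one_add_sq, abs_of_pos (by positivity), smul_eq_mul, ← mul_assoc,
        mul_inv_cancel₀ (Real.exp_pos u).ne', one_mul]
    have h2 : Integrable fun x => Real.exp u * (1 + (Real.exp u * x) ^ 2)⁻¹ :=
      (integrable_inv_one_add_sq.comp_mul_left' (Real.exp_pos u).ne').const_mul _
    rw [← h1, ofReal_integral_eq_lintegral_ofReal h2 (Eventually.of_forall fun x => by positivity)]
    refine lintegral_mono fun x => ?_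
    rw [← ofReal_norm, ← ENNReal.ofReal_pow (norm_nonneg _)]
    refine ENNReal.ofReal_le_ofReal ?_
    rw [norm_mul, mul_pow, Real.norm_eq_abs, Real.norm_eq_abs, Real.abs_exp, ← Real.exp_nat_mul]
    have h3 : ((2 : ℕ) : ℝ) * (u / 2) = u := by push_cast; ring
    rw [h3]
    gcongr
    calc |modeKernel ν (Real.exp u * x)| ^ 2 ≤ ((Real.sqrt (1 + (Real.exp u * x) ^ 2))⁻¹) ^ 2 := by
          gcongr; exact abs_modeKernel_le _ _
      _ = _ := by rw [inv_pow, Real.sq_sqrt (by positivity)]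
  · have h0 : ∀ᵐ x : ℝ, x ≠ 0 := by simp [ae_iff]
    filter_upwards [h0] with x hx
    refine squeeze_zero_norm (fun u => ?_) (hl x hx)
    rw [norm_mul, Real.norm_eq_abs, Real.norm_eq_abs, Real.abs_exp]
    gcongr
    exact abs_modeKernel_le _ _

theorem tendsto_logPairing_atBot {f : ℝ → ℂ} (hf : MemLp f 2) (ν : ℝ) :
    Tendsto (logPairing f ν) atBot (𝓝 0) := by
  refine tendsto_logPairing hf ν fun x _ => ?_
  have h : Tendsto (fun u : ℝ => Real.exp (u / 2)) atBot (𝓝 0) :=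
    Real.tendsto_exp_atBot.comp (tendsto_id.atBot_div_const two_pos)
  refine squeeze_zero (fun u => by positivity) (fun u => ?_) h
  refine mul_le_of_le_one_right (Real.exp_pos _).le (inv_le_one_of_one_le₀ ?_)
  rw [Real.one_le_sqrt]
  linarith [sq_nonneg (Real.exp u * x)]

theorem tendsto_logPairing_atTop {f : ℝ → ℂ} (hf : MemLp f 2) (ν : ℝ) :
    Tendsto (logPairing f ν) atTop (𝓝 0) := by
  refine tendsto_logPairing hf ν fun x hx => ?_
  have h : Tendsto (fun u : ℝ => Real.exp (-(u / 2)) * |x|⁻¹) atTop (𝓝 0) := by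
    have h1 : Tendsto (fun u : ℝ => Real.exp (-(u / 2))) atTop (𝓝 0) :=
      Real.tendsto_exp_neg_atTop_nhds_zero.comp (tendsto_id.atTop_div_const two_pos)
    simpa using h1.mul_const |x|⁻¹
  refine squeeze_zero (fun u => by positivity) (fun u => ?_) h
  have h2 : Real.exp (-(u / 2)) = Real.exp (u / 2) * (Real.exp u)⁻¹ := by
    rw [← Real.exp_neg, ← Real.exp_add]
    ring_nf
  rw [h2, mul_assoc, ← mul_inv]
  have hx' : 0 < |x| := abs_pos.2 hx
  gcongr
  refine Real.le_sqrt_of_sq_le ?_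
  rw [mul_pow, sq_abs, mul_pow]
  linarith

theorem logPairing_neg (f : ℝ → ℂ) (ν u : ℝ) : logPairing f (-ν) u = logPairing f ν u := by
  simp only [logPairing, modeKernel_neg]

/-- If one mode pairing vanishes identically, all of them do. -/
theorem logPairing_eq_zero {f : ℝ → ℂ} (hf : MemLp f 2) {n : ℕ} (h : logPairing f n = 0) (k : ℕ) :
    logPairing f k = 0 := by
  let V : Submodule ℂ (ℝ → ℂ) := Submodule.span ℂ (range fun n : ℤ => logPairing f n)
  have hmem : ∀ n : ℤ, logPairing f n ∈ V := fun n => Submodule.subset_span ⟨n, rfl⟩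
  have hd0 : ∀ n : ℤ, deriv (logPairing f n) = ((n / 2 + 1 / 4 : ℝ) : ℂ) • logPairing f (n + 1 : ℤ)
      - ((n / 2 - 1 / 4 : ℝ) : ℂ) • logPairing f (n - 1 : ℤ) := by
    intro n
    ext u
    rw [(hasDerivAt_logPairing hf n u).deriv]
    simp
  have hd : ∀ v ∈ V, Differentiable ℝ v := by
    intro v hv
    induction hv using Submodule.span_induction with
    | mem v hv =>
      obtain ⟨n, rfl⟩ := hv
      exact fun u => (hasDerivAt_logPairing hf n u).differentiableAt
    | zero => exact differentiable_const 0
    | add v w _ _ hv hw => exact hv.add hw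
    | smul c v _ hv => exact hv.const_smul c
  have hV : ∀ v ∈ V, deriv v ∈ V := by
    intro v hv
    induction hv using Submodule.span_induction with
    | mem v hv =>
      obtain ⟨n, rfl⟩ := hv
      simp only [hd0]
      exact V.sub_mem (V.smul_mem _ (hmem _)) (V.smul_mem _ (hmem _))
    | zero =>
      have : deriv (0 : ℝ → ℂ) = 0 := by ext u; exact deriv_const u 0
      rw [this]
      exact V.zero_mem
    | add v w hv hw hv' hw' =>
      have : deriv (v + w) = deriv v + deriv w := by
        ext u; exact deriv_add (hd v hv u) (hd w hw u)
      rw [this]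
      exact V.add_mem hv' hw'
    | smul c v hv hv' =>
      have : deriv (c • v) = c • deriv v := by
        ext u; exact deriv_const_smul c (hd v hv u)
      rw [this]
      exact V.smul_mem c hv'
  have hlim : ∀ l : Filter ℝ, (∀ n : ℤ, Tendsto (logPairing f n) l (𝓝 0)) →
      ∀ v ∈ V, Tendsto v l (𝓝 0) := by
    intro l hl v hv
    induction hv using Submodule.span_induction with
    | mem v hv => obtain ⟨n, rfl⟩ := hv; exact hl n
    | zero => exact tendsto_const_nhds
    | add v w _ _ hv hw =>
      change Tendsto (fun u => v u + w u) l (𝓝 0)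
      simpa using hv.add hw
    | smul c v _ hv =>
      change Tendsto (fun u => c • v u) l (𝓝 0)
      simpa using hv.const_smul c
  let D := derivOn V hd hV
  let φ : ℕ → V := fun n => ⟨logPairing f n, by exact_mod_cast hmem n⟩
  have hD0 : D (φ 0) = (1 / 2 : ℂ) • φ 1 := by
    ext u
    have h1 := congrFun (hd0 0) u
    have h2 := logPairing_neg f 1 u
    simp only [D, φ, derivOn]
    simp at h1 ⊢
    rw [h1, h2]
    ring
  have hD : ∀ n : ℕ, D (φ (n + 1)) = (((n + 1 : ℕ) / 2 + 1 / 4 : ℝ) : ℂ) • φ (n + 2)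
      - (((n + 1 : ℕ) / 2 - 1 / 4 : ℝ) : ℂ) • φ n := by
    intro n
    ext u
    have h1 := congrFun (hd0 (n + 1 : ℕ)) u
    have e1 : ((((n + 1 : ℕ) : ℤ) + 1 : ℤ) : ℝ) = ((n + 2 : ℕ) : ℝ) := by push_cast; ring
    have e2 : ((((n + 1 : ℕ) : ℤ) - 1 : ℤ) : ℝ) = (n : ℝ) := by push_cast; ring
    rw [e1, e2, Int.cast_natCast] at h1
    exact h1
  have hP : ∀ n : ℕ, (∃ P : ℂ[X], P.degree = n ∧ aeval D P (φ 0) = φ n) ∧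
      ∃ P : ℂ[X], P.degree = (n + 1 : ℕ) ∧ aeval D P (φ 0) = φ (n + 1) := by
    intro n
    induction n with
    | zero =>
      refine ⟨⟨1, by simp, by simp⟩, ⟨C 2 * X, by rw [degree_C_mul_X two_ne_zero]; rfl, ?_⟩⟩
      rw [map_mul, aeval_C, aeval_X, Module.End.mul_apply, Module.algebraMap_end_apply, hD0,
        smul_smul]
      norm_num
    | succ n ih =>
      refine ⟨ih.2, ?_⟩
      obtain ⟨⟨P, hP, hP'⟩, ⟨Q, hQ, hQ'⟩⟩ := ih
      have hα : (((n + 1 : ℕ) / 2 + 1 / 4 : ℝ) : ℂ) ≠ 0 := by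
        rw [Complex.ofReal_ne_zero]; positivity
      refine ⟨C (((n + 1 : ℕ) / 2 + 1 / 4 : ℝ) : ℂ)⁻¹ *
        (X * Q + C (((n + 1 : ℕ) / 2 - 1 / 4 : ℝ) : ℂ) * P), ?_, ?_⟩
      · have h1 : (X * Q).degree = ((n + 1 + 1 : ℕ) : WithBot ℕ) := by
          rw [degree_mul, degree_X, hQ, add_comm]; rfl
        rw [degree_C_mul (inv_ne_zero hα), degree_add_eq_left_of_degree_lt, h1]
        rw [h1]
        rw [← smul_eq_C_mul]
        refine (degree_smul_le _ _).trans_lt ?_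
        rw [hP]
        exact_mod_cast (by omega : n < n + 1 + 1)
      · simp only [map_mul, map_add, aeval_C, aeval_X, Module.End.mul_apply, LinearMap.add_apply,
          Module.algebraMap_end_apply, hP', hQ', hD n]
        rw [← smul_add, sub_add_cancel, smul_smul, inv_mul_cancel₀ hα, one_smul]
  have h0 : φ 0 = 0 := by
    obtain ⟨P, hP1, hP2⟩ := (hP n).1
    refine aeval_derivOn_injective hd hV (hlim _ fun n => tendsto_logPairing_atTop hf n)
      (hlim _ fun n => tendsto_logPairing_atBot hf n) _ P (fun h => by simp [h] at hP1) rfl (φ 0) ?_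
    exact hP2.trans (Subtype.ext h)
  obtain ⟨P, -, hP2⟩ := (hP k).1
  rw [h0, map_zero] at hP2
  exact (congrArg Subtype.val hP2).symm

theorem modePairing_eq {f : ℝ → ℂ} (ν : ℝ) {a : ℝ} (ha : 0 < a) :
    modePairing f ν a = Real.exp (-(Real.log a / 2)) * logPairing f ν (Real.log a) := by
  rw [logPairing_eq, Real.exp_log ha, ← mul_assoc, ← Complex.ofReal_mul, ← Real.exp_add]
  simp

theorem continuousOn_modePairing {f : ℝ → ℂ} (hf : MemLp f 2) (ν : ℝ) :
    ContinuousOn (modePairing f ν) (Ioi 0) := by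
  have h1 : Continuous (logPairing f ν) := continuous_iff_continuousAt.2 fun u =>
    (hasDerivAt_logPairing hf ν u).continuousAt
  have h2 : ContinuousOn Real.log (Ioi 0) := Real.continuousOn_log.mono fun x hx => ne_of_gt hx
  refine ContinuousOn.congr (f := fun a => (Real.exp (-(Real.log a / 2)) : ℂ)
    * logPairing f ν (Real.log a)) ?_ fun a ha => modePairing_eq ν ha
  refine ContinuousOn.mul ?_ (h1.comp_continuousOn h2)
  exact Complex.continuous_ofReal.comp_continuousOn (Real.continuous_exp.comp_continuousOn
    (h2.div_const 2).neg)

theorem dilationEnergy_neg {γ : Signal} (heven : IsEven γ) (n : ℤ) :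
    dilationEnergy γ (-n) = dilationEnergy γ n := by
  rw [dilationEnergy_eq heven, dilationEnergy_eq heven]
  simp only [Int.cast_neg, modePairing_neg]

/-- Every mode carries energy. -/
theorem dilationEnergy_ne_zero {γ : Signal} (heven : IsEven γ) (hγ : γ ≠ 0) (n : ℕ) :
    dilationEnergy γ n ≠ 0 := by
  intro h
  have hf := memLp_lineFun γ
  have hcont := continuousOn_modePairing hf n
  rw [dilationEnergy_eq heven, lintegral_eq_zero_iff'] at h
  swap
  · have := hcont.aemeasurable (μ := volume) measurableSet_Ioi
    simp only [Int.cast_natCast]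
    exact (this.enorm.pow_const 2).mul (by fun_prop)
  have hz : modePairing (lineFun γ) n =ᵐ[volume.restrict (Ioi 0)] fun _ => 0 := by
    filter_upwards [h, ae_restrict_mem measurableSet_Ioi] with a ha (ha' : 0 < a)
    simpa [ha'] using ha
  have hz' := Measure.eqOn_open_of_ae_eq hz isOpen_Ioi hcont continuousOn_const
  have hl : logPairing (lineFun γ) n = 0 := by
    ext u
    rw [logPairing_eq, hz' (Real.exp_pos u)]
    simp
  have hc : ∀ k : ℤ, circleCoeff (transformFun 0 1 γ) k = 0 := by
    intro k
    rw [circleCoeff_transformFun heven k one_pos, modePairing_eq _ one_pos]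
    have h1 := logPairing_eq_zero hf hl k.natAbs
    have h2 : logPairing (lineFun γ) k = 0 := by
      rcases Int.natAbs_eq k with hk | hk
      · have h2 := congrArg (Int.cast : ℤ → ℝ) hk
        rw [Int.cast_natCast] at h2
        rw [h2, h1]
      · have h2 := congrArg (Int.cast : ℤ → ℝ) hk
        rw [Int.cast_neg, Int.cast_natCast] at h2
        ext u
        rw [h2, logPairing_neg, h1]
    rw [h2]
    simp
  have h3 := lintegral_enorm_sq_eq_tsum (memLp_transformFun one_pos 0 γ)
  simp only [hc, enorm_zero, ne_eq, OfNat.ofNat_ne_zero, not_false_eq_true, zero_pow, tsum_zero,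
    mul_zero] at h3
  rw [lintegral_transformFun one_pos, ← enorm_signal_sq] at h3
  exact hγ (by simpa using h3)

end

section

open Filter Topology FourierTransform
open scoped ENNReal NNReal

/-- The average `∫_0^β cos (2by) db`. -/
noncomputable def cosAverage (β y : ℝ) : ℝ := ∫ b in (0 : ℝ)..β, Real.cos (2 * b * y)

theorem cosAverage_eq (β : ℝ) {y : ℝ} (hy : y ≠ 0) :
    cosAverage β y = Real.sin (2 * β * y) / (2 * y) := by
  have h : ∀ b : ℝ, HasDerivAt (fun b => Real.sin (2 * b * y) / (2 * y)) (Real.cos (2 * b * y)) b := by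
    intro b
    have h1 : HasDerivAt (fun b : ℝ => 2 * b * y) (2 * y) b := by
      simpa using ((hasDerivAt_id b).const_mul 2).mul_const y
    refine (h1.sin.div_const (2 * y)).congr_deriv ?_
    field_simp
  rw [cosAverage, intervalIntegral.integral_eq_sub_of_hasDerivAt (fun b _ => h b)
    (Continuous.intervalIntegrable (by fun_prop) _ _)]
  simp

theorem cosAverage_neg (β y : ℝ) : cosAverage (-β) y = -cosAverage β y := by
  rcases eq_or_ne y 0 with rfl | hy
  · simp [cosAverage]
  · rw [cosAverage_eq _ hy, cosAverage_eq _ hy, mul_neg, neg_mul, Real.sin_neg, neg_div]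

theorem cosAverage_apply_neg (β y : ℝ) : cosAverage β (-y) = cosAverage β y := by
  simp only [cosAverage, mul_neg, Real.cos_neg]

theorem cosAverage_one_mul_cos (β y : ℝ) : cosAverage 1 y * Real.cos (2 * β * y)
    = (cosAverage (1 + β) y + cosAverage (1 - β) y) / 2 := by
  rcases eq_or_ne y 0 with rfl | hy
  · simp [cosAverage]
  · rw [cosAverage_eq _ hy, cosAverage_eq _ hy, cosAverage_eq _ hy]
    have e1 : 2 * (1 + β) * y = 2 * 1 * y + 2 * β * y := by ring
    have e2 : 2 * (1 - β) * y = 2 * 1 * y - 2 * β * y := by ring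
    rw [e1, e2, Real.sin_add, Real.sin_sub]
    ring

theorem inv_one_add_le_rpow {x : ℝ} (hx : 0 ≤ x) : (1 + x)⁻¹ ≤ (1 + x) ^ (-(3 / 4) : ℝ) := by
  rw [← Real.rpow_neg_one]
  exact Real.rpow_le_rpow_of_exponent_le (by linarith) (by norm_num)

theorem abs_cosAverage_le_abs (β y : ℝ) : |cosAverage β y| ≤ |β| := by
  have h := intervalIntegral.norm_integral_le_of_norm_le_const (a := 0) (b := β) (C := 1)
    (f := fun b => Real.cos (2 * b * y)) (fun b _ => Real.abs_cos_le_one _)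
  simpa [cosAverage] using h

theorem abs_cosAverage_le (β y : ℝ) :
    |cosAverage β y| ≤ 2 * (|β| + 1) * (1 + |y|) ^ (-(3 / 4) : ℝ) := by
  refine le_trans ?_ (mul_le_mul_of_nonneg_left (inv_one_add_le_rpow (abs_nonneg y))
    (by positivity))
  rw [← div_eq_mul_inv, le_div_iff₀ (by positivity)]
  have h1 := abs_cosAverage_le_abs β y
  have h2 : |cosAverage β y| * |y| ≤ 1 := by
    rcases eq_or_ne y 0 with rfl | hy
    · simp
    · rw [cosAverage_eq β hy, abs_div, abs_mul, abs_two]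
      have := abs_pos.2 hy
      rw [div_mul_eq_mul_div, div_le_one (by positivity)]
      nlinarith [Real.abs_sin_le_one (2 * β * y)]
  nlinarith [abs_nonneg β]

theorem continuous_cosAverage (β : ℝ) : Continuous (cosAverage β) :=
  intervalIntegral.continuous_parametric_intervalIntegral_of_continuous' (by fun_prop) 0 β

theorem integrable_mul_cosAverage {f : ℝ → ℂ} (hf : MemLp f 2) (β : ℝ) :
    Integrable fun y => f y * cosAverage β y :=
  integrable_mul_of_abs_le hf (continuous_cosAverage β).aestronglyMeasurable (abs_cosAverage_le β)

/-- An even square integrable function is determined by its pairings with `sin (2βy) / (2y)`. -/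
theorem ae_eq_zero_of_integral_mul_cosAverage {f : ℝ → ℂ} (hf : MemLp f 2)
    (heven : ∀ᵐ y, f (-y) = f y) (h : ∀ β > 0, ∫ y, f y * cosAverage β y = 0) :
    ∀ᵐ y, f y = 0 := by
  have hall : ∀ β : ℝ, ∫ y, f y * cosAverage β y = 0 := by
    intro β
    rcases lt_trichotomy β 0 with hβ | rfl | hβ
    · have h1 := h (-β) (by linarith)
      simp only [cosAverage_neg, Complex.ofReal_neg, mul_neg, integral_neg, neg_eq_zero] at h1
      exact h1
    · simp [cosAverage]
    · exact h β hβ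
  let g : ℝ → ℂ := fun y => f y * cosAverage 1 y
  have hg : Integrable g := integrable_mul_cosAverage hf 1
  have hfour : ∀ ξ, 𝓕 g ξ = 0 := by
    intro ξ
    have hgs : Integrable fun y => g y * (Real.sin (2 * (Real.pi * ξ) * y) : ℂ) := by
      refine hg.mul_bdd (c := 1) (by fun_prop) (Eventually.of_forall fun y => ?_)
      rw [Complex.norm_real]
      exact Real.abs_sin_le_one _
    have hgc : Integrable fun y => g y * (Real.cos (2 * (Real.pi * ξ) * y) : ℂ) := by
      refine hg.mul_bdd (c := 1) (by fun_prop) (Eventually.of_forall fun y => ?_)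
      rw [Complex.norm_real]
      exact Real.abs_cos_le_one _
    have hs : ∫ y, g y * (Real.sin (2 * (Real.pi * ξ) * y) : ℂ) = 0 := by
      have h1 : ∫ y, g y * (Real.sin (2 * (Real.pi * ξ) * y) : ℂ)
          = ∫ y, -(g y * (Real.sin (2 * (Real.pi * ξ) * y) : ℂ)) := by
        rw [← integral_neg_eq_self]
        refine integral_congr_ae ?_
        filter_upwards [heven] with y hy
        simp only [g]
        rw [hy, cosAverage_apply_neg, mul_neg, Real.sin_neg]
        push_cast
        ring
      rw [integral_neg] at h1
      exact self_eq_neg.1 h1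
    have hc : ∫ y, g y * (Real.cos (2 * (Real.pi * ξ) * y) : ℂ) = 0 := by
      have h1 : ∀ y, g y * (Real.cos (2 * (Real.pi * ξ) * y) : ℂ)
          = (1 / 2 : ℂ) * (f y * cosAverage (1 + Real.pi * ξ) y
            + f y * cosAverage (1 - Real.pi * ξ) y) := by
        intro y
        have h2 := congrArg (Complex.ofReal) (cosAverage_one_mul_cos (Real.pi * ξ) y)
        rw [Complex.ofReal_mul] at h2
        simp only [g]
        rw [mul_assoc (f y), h2]
        push_cast
        ring
      simp only [h1]
      rw [integral_const_mul, integral_add (integrable_mul_cosAverage hf _)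
        (integrable_mul_cosAverage hf _), hall, hall]
      simp
    rw [Real.fourier_real_eq_integral_exp_smul]
    have h1 : ∀ y : ℝ, Complex.exp ((-2 * Real.pi * y * ξ : ℝ) * Complex.I) • g y
        = g y * (Real.cos (2 * (Real.pi * ξ) * y) : ℂ)
          - Complex.I * (g y * (Real.sin (2 * (Real.pi * ξ) * y) : ℂ)) := by
      intro y
      have e : -2 * Real.pi * y * ξ = -(2 * (Real.pi * ξ) * y) := by ring
      rw [e, Complex.exp_mul_I, ← Complex.ofReal_cos, ← Complex.ofReal_sin, Real.cos_neg,
        Real.sin_neg, smul_eq_mul]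
      push_cast
      ring
    simp only [h1]
    rw [integral_sub hgc (hgs.const_mul _), integral_const_mul, hs, hc]
    simp
  have hz := ae_eq_zero_of_fourier_eq_zero hg hfour
  have hcount : ∀ᵐ y : ℝ, Real.sin (2 * 1 * y) ≠ 0 := by
    have h1 : (range fun k : ℤ => (k : ℝ) * Real.pi / 2).Countable := countable_range _
    filter_upwards [h1.ae_notMem volume] with y hy h0
    obtain ⟨k, hk⟩ := Real.sin_eq_zero_iff.1 h0
    exact hy ⟨k, by simp only; linarith⟩
  filter_upwards [hz, hcount] with y hy hs
  have hy0 : y ≠ 0 := by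
    rintro rfl
    simp at hs
  refine (mul_eq_zero.1 hy).resolve_right ?_
  rw [cosAverage_eq 1 hy0, Complex.ofReal_eq_zero]
  positivity

end

section

open Filter Topology
open scoped ENNReal NNReal

/-- The rescaled average `∫_0^β C_n(by/n) db` of the mode kernel. -/
noncomputable def modeAverage (n : ℕ) (β y : ℝ) : ℝ :=
  ∫ b in (0 : ℝ)..β, modeKernel n (b * (y / n))

theorem continuous_modeAverage (n : ℕ) (β : ℝ) : Continuous (modeAverage n β) :=
  intervalIntegral.continuous_parametric_intervalIntegral_of_continuous' (by fun_prop) 0 β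

theorem abs_modeKernel_le_one (ν t : ℝ) : |modeKernel ν t| ≤ 1 := by
  refine (abs_modeKernel_le ν t).trans (inv_le_one_of_one_le₀ ?_)
  rw [Real.one_le_sqrt]
  linarith [sq_nonneg t]

theorem modeAverage_apply_neg (n : ℕ) (β y : ℝ) : modeAverage n β (-y) = modeAverage n β y := by
  simp only [modeAverage, neg_div, mul_neg, modeKernel_apply_neg]

theorem abs_modeAverage_le_self (n : ℕ) {β : ℝ} (hβ : 0 ≤ β) (y : ℝ) : |modeAverage n β y| ≤ β := by
  have h := intervalIntegral.norm_integral_le_of_norm_le_const (a := 0) (b := β) (C := 1)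
    (f := fun b => modeKernel n (b * (y / n))) (fun b _ => abs_modeKernel_le_one _ _)
  simpa [modeAverage, abs_of_nonneg hβ] using h

theorem modeAverage_eq {n : ℕ} (hn : n ≠ 0) (β : ℝ) {y : ℝ} (hy : y ≠ 0) :
    modeAverage n β y = n / y * ∫ t in (0 : ℝ)..(β * y / n), modeKernel n t := by
  have hn' : (n : ℝ) ≠ 0 := by exact_mod_cast hn
  rw [modeAverage, intervalIntegral.integral_comp_mul_right (fun t => modeKernel n t)
    (div_ne_zero hy hn'), zero_mul, smul_eq_mul, inv_div, mul_div_assoc]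

theorem sqrt_one_add_sq_le {T : ℝ} (hT : 0 ≤ T) : Real.sqrt (1 + T ^ 2) ≤ 1 + T := by
  rw [Real.sqrt_le_left (by linarith)]
  nlinarith

theorem abs_integral_modeKernel_le {n : ℕ} (hn : n ≠ 0) {T : ℝ} (hT : 0 ≤ T) :
    |∫ t in (0 : ℝ)..T, modeKernel n t| ≤ (1 + T) / n := by
  have hn' : (0 : ℝ) < n := by exact_mod_cast Nat.pos_of_ne_zero hn
  let F : ℝ → ℝ := fun t => Real.sin (2 * n * Real.arctan t) * Real.sqrt (1 + t ^ 2) / (2 * n)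
  let r : ℝ → ℝ := fun t => Real.sin (2 * n * Real.arctan t) * (t / Real.sqrt (1 + t ^ 2)) / (2 * n)
  have hF : ∀ t, HasDerivAt F (modeKernel n t + r t) t := by
    intro t
    have hpos : (0 : ℝ) < 1 + t ^ 2 := by positivity
    have h1 : HasDerivAt (fun t => Real.sin (2 * n * Real.arctan t))
        (Real.cos (2 * n * Real.arctan t) * (2 * n * (1 / (1 + t ^ 2)))) t :=
      ((Real.hasDerivAt_arctan t).const_mul (2 * (n : ℝ))).sin
    have h2 : HasDerivAt (fun t : ℝ => Real.sqrt (1 + t ^ 2)) (t / Real.sqrt (1 + t ^ 2)) t := by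
      have h3 : HasDerivAt (fun t : ℝ => 1 + t ^ 2) (2 * t) t := by
        simpa using (hasDerivAt_pow 2 t).const_add 1
      refine (h3.sqrt hpos.ne').congr_deriv ?_
      field_simp
    refine ((h1.mul h2).div_const (2 * (n : ℝ))).congr_deriv ?_
    simp only [modeKernel, r]
    have hs0 : Real.sqrt (1 + t ^ 2) ≠ 0 := (Real.sqrt_pos.2 hpos).ne'
    have hs : 1 + t ^ 2 = Real.sqrt (1 + t ^ 2) ^ 2 := (Real.sq_sqrt hpos.le).symm
    have e : 1 / (1 + t ^ 2) * Real.sqrt (1 + t ^ 2) = (Real.sqrt (1 + t ^ 2))⁻¹ := by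
      conv_lhs => rw [hs]
      rw [Real.sqrt_sq (Real.sqrt_nonneg _)]
      field_simp
    rw [← e]
    field_simp
  have hrc : Continuous r := by
    have h2 := Real.continuous_arctan
    have h3 := continuous_inv_sqrt_one_add_sq
    simp only [r, div_eq_mul_inv]
    fun_prop
  have hint := intervalIntegral.integral_eq_sub_of_hasDerivAt (a := 0) (b := T) (fun t _ => hF t)
    (((continuous_modeKernel n).add hrc).intervalIntegrable _ _)
  rw [intervalIntegral.integral_add ((continuous_modeKernel n).intervalIntegrable _ _)
    (hrc.intervalIntegrable _ _)] at hint
  have hF0 : F 0 = 0 := by simp [F]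
  have hFT : |F T| ≤ (1 + T) / (2 * n) := by
    simp only [F]
    rw [abs_div, abs_mul, abs_of_nonneg (Real.sqrt_nonneg _), abs_of_pos (by positivity : (0 : ℝ) < 2 * n)]
    gcongr
    calc _ ≤ 1 * Real.sqrt (1 + T ^ 2) := by gcongr; exact Real.abs_sin_le_one _
      _ ≤ _ := by rw [one_mul]; exact sqrt_one_add_sq_le hT
  have hr : |∫ t in (0 : ℝ)..T, r t| ≤ T / (2 * n) := by
    have h := intervalIntegral.norm_integral_le_of_norm_le_const (a := 0) (b := T)
      (C := 1 / (2 * n)) (f := r) (fun t _ => by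
        simp only [r, Real.norm_eq_abs]
        rw [abs_div, abs_mul, abs_of_pos (by positivity : (0 : ℝ) < 2 * n)]
        gcongr
        have h1 : |t / Real.sqrt (1 + t ^ 2)| ≤ 1 := by
          have hpos : 0 < Real.sqrt (1 + t ^ 2) := Real.sqrt_pos.2 (by positivity)
          rw [abs_div, abs_of_pos hpos, div_le_one hpos]
          exact Real.abs_le_sqrt (by linarith)
        exact mul_le_one₀ (Real.abs_sin_le_one _) (abs_nonneg _) h1)
    rw [Real.norm_eq_abs, sub_zero, abs_of_nonneg hT] at h
    calc _ ≤ 1 / (2 * n) * T := h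
      _ = _ := by ring
  have e : ∫ t in (0 : ℝ)..T, modeKernel n t = F T - ∫ t in (0 : ℝ)..T, r t := by
    rw [hF0] at hint
    linarith
  rw [e]
  calc _ ≤ |F T| + |∫ t in (0 : ℝ)..T, r t| := abs_sub _ _
    _ ≤ (1 + T) / (2 * n) + T / (2 * n) := add_le_add hFT hr
    _ = (1 / 2 + T) / n := by field_simp; ring
    _ ≤ _ := by gcongr; norm_num

theorem abs_integral_modeKernel_le_rpow {n : ℕ} (hn : n ≠ 0) {T : ℝ} (hT : n ≤ T) :
    |∫ t in (0 : ℝ)..T, modeKernel n t| ≤ 6 * (T / n) ^ (1 / 4 : ℝ) := by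
  have hn' : (0 : ℝ) < n := by exact_mod_cast Nat.pos_of_ne_zero hn
  have hn1 : (1 : ℝ) ≤ n := by exact_mod_cast Nat.one_le_iff_ne_zero.2 hn
  have hT0 : 0 < T := hn'.trans_le hT
  have hci := fun a b => (continuous_modeKernel n).intervalIntegrable (μ := volume) a b
  rw [← intervalIntegral.integral_add_adjacent_intervals (hci 0 n) (hci n T)]
  have h1 : |∫ t in (0 : ℝ)..n, modeKernel n t| ≤ 2 := by
    refine (abs_integral_modeKernel_le hn hn'.le).trans ?_
    rw [div_le_iff₀ hn']
    linarith
  have h2 : |∫ t in (n : ℝ)..T, modeKernel n t| ≤ Real.log (T / n) := by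
    rw [← integral_inv_of_pos hn' hT0]
    rw [← Real.norm_eq_abs]
    refine intervalIntegral.norm_integral_le_of_norm_le (μ := volume) hT
      (ae_of_all _ fun t ht => ?_) ?_
    · have ht0 : 0 < t := hn'.trans ht.1
      refine (abs_modeKernel_le _ _).trans ?_
      gcongr
      exact Real.le_sqrt_of_sq_le (by linarith)
    · refine intervalIntegral.intervalIntegrable_inv (fun t ht => ?_) continuousOn_id
      rw [uIcc_of_le hT] at ht
      exact (hn'.trans_le ht.1).ne'
  have h3 : Real.log (T / n) ≤ (T / n) ^ (1 / 4 : ℝ) / (1 / 4) :=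
    Real.log_le_rpow_div (by positivity) (by norm_num)
  have h4 : 1 ≤ (T / n) ^ (1 / 4 : ℝ) :=
    Real.one_le_rpow ((one_le_div hn').2 hT) (by norm_num)
  calc _ ≤ 2 + Real.log (T / n) := (abs_add_le _ _).trans (add_le_add h1 h2)
    _ ≤ _ := by linarith

theorem abs_modeAverage_le {n : ℕ} (hn : n ≠ 0) {β : ℝ} (hβ : 0 < β) (y : ℝ) :
    |modeAverage n β y| ≤ 2 * (β + 1) * (1 + |y|) ^ (-(3 / 4) : ℝ)
      + 12 * β / n * (1 + |β / n ^ 2 * y|) ^ (-(3 / 4) : ℝ) := by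
  wlog hy : 0 ≤ y generalizing y
  · have h := this (-y) (by linarith)
    rwa [modeAverage_apply_neg, abs_neg, mul_neg, abs_neg] at h
  have hn' : (0 : ℝ) < n := by exact_mod_cast Nat.pos_of_ne_zero hn
  rw [abs_of_nonneg hy, abs_of_nonneg (mul_nonneg (by positivity) hy)]
  set z := β / n ^ 2 * y with hz
  have hz0 : 0 ≤ z := mul_nonneg (by positivity) hy
  have hA : (1 + y)⁻¹ ≤ (1 + y) ^ (-(3 / 4) : ℝ) := inv_one_add_le_rpow hy
  have hZ : (1 + z)⁻¹ ≤ (1 + z) ^ (-(3 / 4) : ℝ) := inv_one_add_le_rpow hz0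
  have hA0 : 0 < (1 + y)⁻¹ := by positivity
  have hZ0 : 0 < (1 + z)⁻¹ := by positivity
  rcases le_total y 1 with hy1 | hy1
  · have h1 := abs_modeAverage_le_self n hβ.le y
    have h2 : (1 / 2 : ℝ) ≤ (1 + y)⁻¹ := by
      rw [one_div]; gcongr; linarith
    have h3 : 0 ≤ 12 * β / n * (1 + z) ^ (-(3 / 4) : ℝ) := by positivity
    nlinarith
  have hy0 : 0 < y := by linarith
  rw [modeAverage_eq hn β hy0.ne', abs_mul, abs_of_pos (by positivity : 0 < n / y)]
  rcases le_total z 1 with hz1 | hz1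
  · have h1 := abs_integral_modeKernel_le hn (T := β * y / n) (by positivity)
    have h2 : n / y * |∫ t in (0 : ℝ)..(β * y / n), modeKernel n t| ≤ 1 / y + β / n := by
      calc _ ≤ n / y * ((1 + β * y / n) / n) := by gcongr
        _ = _ := by field_simp
    have h3 : 1 / y ≤ 2 * (1 + y)⁻¹ := by
      rw [← div_eq_mul_inv, div_le_div_iff₀ hy0 (by positivity)]
      linarith
    have h4 : (1 / 2 : ℝ) ≤ (1 + z)⁻¹ := by
      rw [one_div]; gcongr; linarith
    have h5 : β / n ≤ 12 * β / n * (1 + z) ^ (-(3 / 4) : ℝ) := by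
      have : 0 < β / n := by positivity
      calc β / n = 2 * (β / n) * (1 / 2) := by ring
        _ ≤ 12 * (β / n) * (1 + z) ^ (-(3 / 4) : ℝ) := by
          gcongr
          · norm_num
          · linarith
        _ = _ := by ring
    have h6 : 2 * (1 + y)⁻¹ ≤ 2 * (β + 1) * (1 + y) ^ (-(3 / 4) : ℝ) := by
      gcongr
      linarith
    linarith
  · have hzp : 0 < z := by linarith
    have hzT : β * y / n / n = z := by rw [hz]; field_simp
    have hT : (n : ℝ) ≤ β * y / n := by
      have h1 : β * y / n = z * n := by rw [← hzT]; field_simp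
      rw [h1]
      exact le_mul_of_one_le_left hn'.le hz1
    have h1 := abs_integral_modeKernel_le_rpow hn hT
    rw [hzT] at h1
    have h2 : n / y = β / n * z⁻¹ := by rw [hz]; field_simp
    have h3 : z⁻¹ * z ^ (1 / 4 : ℝ) = z ^ (-(3 / 4) : ℝ) := by
      rw [← Real.rpow_neg_one, ← Real.rpow_add hzp]
      norm_num
    have h4 : z ^ (-(3 / 4) : ℝ) ≤ 2 * (1 + z) ^ (-(3 / 4) : ℝ) := by
      have h5 : ((2 : ℝ) * z) ^ (-(3 / 4) : ℝ) ≤ (1 + z) ^ (-(3 / 4) : ℝ) :=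
        Real.rpow_le_rpow_of_nonpos (by linarith) (by linarith) (by norm_num)
      rw [Real.mul_rpow two_pos.le hzp.le] at h5
      have h6 : (2 : ℝ)⁻¹ ≤ 2 ^ (-(3 / 4) : ℝ) := by
        rw [← Real.rpow_neg_one]
        exact Real.rpow_le_rpow_of_exponent_le one_le_two (by norm_num)
      have h7 : 0 < z ^ (-(3 / 4) : ℝ) := Real.rpow_pos_of_pos hzp _
      nlinarith
    have h8 : 0 ≤ 2 * (β + 1) * (1 + y) ^ (-(3 / 4) : ℝ) := by positivity
    calc n / y * |∫ t in (0 : ℝ)..(β * y / n), modeKernel n t|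
        ≤ n / y * (6 * z ^ (1 / 4 : ℝ)) := by gcongr
      _ = 6 * (β / n) * (z⁻¹ * z ^ (1 / 4 : ℝ)) := by rw [h2]; ring
      _ ≤ 6 * (β / n) * (2 * (1 + z) ^ (-(3 / 4) : ℝ)) := by rw [h3]; gcongr
      _ = 12 * β / n * (1 + z) ^ (-(3 / 4) : ℝ) := by ring
      _ ≤ _ := by linarith

theorem tendsto_nat_mul_arctan (c : ℝ) :
    Tendsto (fun n : ℕ => (n : ℝ) * Real.arctan (c / n)) atTop (𝓝 c) := by
  have h1 : HasDerivAt (fun t : ℝ => Real.arctan (c * t)) c 0 := by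
    have h2 : HasDerivAt (fun t : ℝ => c * t) c 0 := by simpa using (hasDerivAt_id (0 : ℝ)).const_mul c
    simpa using h2.arctan
  have h3 := h1.tendsto_slope_zero
  have h4 : Tendsto (fun n : ℕ => ((n : ℝ))⁻¹) atTop (𝓝[≠] 0) := by
    refine tendsto_nhdsWithin_iff.2 ⟨tendsto_inv_atTop_nhds_zero_nat, ?_⟩
    filter_upwards [eventually_ne_atTop 0] with n hn
    simpa using hn
  have h5 := h3.comp h4
  refine h5.congr fun n => ?_
  simp [div_eq_mul_inv]

theorem tendsto_modeKernel (c : ℝ) :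
    Tendsto (fun n : ℕ => modeKernel n (c / n)) atTop (𝓝 (Real.cos (2 * c))) := by
  have h1 : Tendsto (fun n : ℕ => Real.cos (2 * n * Real.arctan (c / n))) atTop
      (𝓝 (Real.cos (2 * c))) := by
    refine (Real.continuous_cos.tendsto _).comp ?_
    refine ((tendsto_nat_mul_arctan c).const_mul 2).congr fun n => ?_
    ring
  have h2 : Tendsto (fun n : ℕ => (Real.sqrt (1 + (c / n) ^ 2))⁻¹) atTop (𝓝 1) := by
    have h3 := (continuous_inv_sqrt_one_add_sq.tendsto 0).comp (tendsto_const_div_atTop_nhds_zero_nat c)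
    simp only [Function.comp_def] at h3
    simpa using h3
  simpa [modeKernel] using h1.mul h2

theorem tendsto_modeAverage (β y : ℝ) :
    Tendsto (fun n : ℕ => modeAverage n β y) atTop (𝓝 (cosAverage β y)) := by
  refine intervalIntegral.tendsto_integral_filter_of_dominated_convergence (fun _ => 1)
    (Eventually.of_forall fun n => ?_) (Eventually.of_forall fun n => ae_of_all _ fun b _ =>
      abs_modeKernel_le_one _ _) intervalIntegrable_const (ae_of_all _ fun b _ => ?_)
  · exact Continuous.aestronglyMeasurable (by fun_prop)
  · have h := tendsto_modeKernel (b * y)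
    simp only [mul_div_assoc, ← mul_assoc] at h ⊢
    exact h

theorem lintegral_sq_sub_le {β : ℝ} (hβ : 0 < β) : ∃ M : ℝ≥0∞, M ≠ ∞ ∧ ∀ n : ℕ, n ≠ 0 →
    ∫⁻ y, ‖modeAverage n β y - cosAverage β y‖ₑ ^ 2 ≤ M := by
  let w : ℝ → ℝ := fun x => (1 + |x|) ^ (-(3 / 2) : ℝ)
  have hw : Integrable w := by
    have := integrable_one_add_norm (E := ℝ) (μ := volume) (r := 3 / 2) (by simp; norm_num)
    simpa using this
  have hw0 : ∀ x, 0 ≤ w x := fun x => by positivity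
  have hsq : ∀ x : ℝ, ((1 + |x|) ^ (-(3 / 4) : ℝ)) ^ 2 = w x := by
    intro x
    rw [← Real.rpow_natCast ((1 + |x|) ^ (-(3 / 4) : ℝ)) 2, ← Real.rpow_mul (by positivity)]
    norm_num [w]
  refine ⟨ENNReal.ofReal ((2 * (4 * (β + 1)) ^ 2 + 288 * β) * ∫ x, w x), ENNReal.ofReal_ne_top,
    fun n hn => ?_⟩
  have hn' : (0 : ℝ) < n := by exact_mod_cast Nat.pos_of_ne_zero hn
  have hc : (0 : ℝ) < β / n ^ 2 := by positivity
  have hi1 : Integrable fun y => 2 * (4 * (β + 1)) ^ 2 * w y := hw.const_mul _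
  have hi2 : Integrable fun y => 2 * (12 * β / n) ^ 2 * w (β / n ^ 2 * y) :=
    (hw.comp_mul_left' hc.ne').const_mul _
  have hi : Integrable fun y => 2 * (4 * (β + 1)) ^ 2 * w y
      + 2 * (12 * β / n) ^ 2 * w (β / n ^ 2 * y) := hi1.add hi2
  have hI : ∫ y, (2 * (4 * (β + 1)) ^ 2 * w y + 2 * (12 * β / n) ^ 2 * w (β / n ^ 2 * y))
      = (2 * (4 * (β + 1)) ^ 2 + 288 * β) * ∫ x, w x := by
    rw [integral_add hi1 hi2, integral_const_mul, integral_const_mul,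
      Measure.integral_comp_mul_left, abs_of_pos (by positivity), smul_eq_mul]
    field_simp
    ring
  rw [← hI, ofReal_integral_eq_lintegral_ofReal hi (Eventually.of_forall fun y =>
    add_nonneg (mul_nonneg (by positivity) (hw0 _)) (mul_nonneg (by positivity) (hw0 _)))]
  refine lintegral_mono fun y => ?_
  rw [← ofReal_norm, ← ENNReal.ofReal_pow (norm_nonneg _)]
  refine ENNReal.ofReal_le_ofReal ?_
  have h1 := abs_modeAverage_le hn hβ y
  have h2 := abs_cosAverage_le β y
  rw [abs_of_pos hβ] at h2
  rw [← hsq, ← hsq, Real.norm_eq_abs]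
  set p := (1 + |y|) ^ (-(3 / 4) : ℝ)
  set q := (1 + |β / n ^ 2 * y|) ^ (-(3 / 4) : ℝ)
  have h3 : |modeAverage n β y - cosAverage β y| ≤ 4 * (β + 1) * p + 12 * β / n * q := by
    refine (abs_sub _ _).trans ?_
    linarith
  calc _ ≤ (4 * (β + 1) * p + 12 * β / n * q) ^ 2 := by gcongr
    _ ≤ 2 * ((4 * (β + 1) * p) ^ 2 + (12 * β / n * q) ^ 2) := add_sq_le
    _ = _ := by ring

theorem tendsto_integral_mul_modeAverage {f : ℝ → ℂ} (hf : MemLp f 2) {β : ℝ} (hβ : 0 < β) :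
    Tendsto (fun n : ℕ => ∫ y, f y * (modeAverage n β y - cosAverage β y : ℝ)) atTop (𝓝 0) := by
  obtain ⟨M, hM, hb⟩ := lintegral_sq_sub_le hβ
  refine tendsto_integral_mul_of_sq_bounded hf
    (fun n => ((continuous_modeAverage n β).sub (continuous_cosAverage β)).measurable) hM
    ((eventually_ne_atTop 0).mono hb) (ae_of_all _ fun y => ?_)
  simpa using (tendsto_modeAverage β y).sub_const (cosAverage β y)

theorem inv_sqrt_le_rpow_mul {n : ℕ} (hn : n ≠ 0) {β b : ℝ} (hb : b ∈ Ioc 0 β) (x : ℝ) :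
    (Real.sqrt (1 + (b * (x / n)) ^ 2))⁻¹
      ≤ (β + n) ^ (3 / 4 : ℝ) * b ^ (-(3 / 4) : ℝ) * (1 + |x|) ^ (-(3 / 4) : ℝ) := by
  have hn' : (0 : ℝ) < n := by exact_mod_cast Nat.pos_of_ne_zero hn
  have hb0 := hb.1
  have hβ : 0 < β := hb.1.trans_le hb.2
  set s := Real.sqrt (1 + (b * (x / n)) ^ 2) with hs
  have h1 : 1 ≤ s := by
    rw [hs, Real.one_le_sqrt]; linarith [sq_nonneg (b * (x / n))]
  have h2 : b * |x| ≤ n * s := by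
    have h3 : |b * (x / n)| ≤ s := Real.abs_le_sqrt (by linarith)
    rw [abs_mul, abs_div, abs_of_pos hb0, abs_of_pos hn', ← mul_div_assoc, div_le_iff₀ hn'] at h3
    linarith
  have h3 : b * (1 + |x|) ≤ (β + n) * s := by nlinarith [hb.2]
  have h4 : (b * (1 + |x|)) ^ (3 / 4 : ℝ) ≤ (β + n) ^ (3 / 4 : ℝ) * s := by
    calc _ ≤ ((β + n) * s) ^ (3 / 4 : ℝ) := by gcongr
      _ = (β + n) ^ (3 / 4 : ℝ) * s ^ (3 / 4 : ℝ) := Real.mul_rpow (by positivity) (by positivity)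
      _ ≤ (β + n) ^ (3 / 4 : ℝ) * s := by
        gcongr
        conv_rhs => rw [← Real.rpow_one s]
        exact Real.rpow_le_rpow_of_exponent_le h1 (by norm_num)
  rw [mul_assoc, ← Real.mul_rpow hb0.le (by positivity), Real.rpow_neg (by positivity),
    ← div_eq_mul_inv, le_div_iff₀ (by positivity), inv_mul_le_iff₀ (by positivity)]
  linarith

theorem integral_modePairing {f : ℝ → ℂ} (hf : MemLp f 2) {n : ℕ} (hn : n ≠ 0) {β : ℝ}
    (hβ : 0 < β) :
    ∫ b in (0 : ℝ)..β, modePairing f n (b / n) = ∫ y, f y * modeAverage n β y := by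
  have hint : Integrable (Function.uncurry fun b x => f x * (modeKernel n (b * (x / n)) : ℂ))
      ((volume.restrict (Ioc 0 β)).prod volume) := by
    have hg1 : Integrable (fun b : ℝ => (β + n) ^ (3 / 4 : ℝ) * b ^ (-(3 / 4) : ℝ))
        (volume.restrict (Ioc 0 β)) := by
      have h := (intervalIntegral.intervalIntegrable_rpow' (a := 0) (b := β)
        (r := -(3 / 4)) (by norm_num)).const_mul ((β + n) ^ (3 / 4 : ℝ))
      rwa [intervalIntegrable_iff_integrableOn_Ioc_of_le hβ.le] at h
    have hg2 : Integrable fun x => ‖f x * ((1 + |x|) ^ (-(3 / 4) : ℝ) : ℝ)‖ := by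
      refine (integrable_mul_of_abs_le hf (k := fun x => (1 + |x|) ^ (-(3 / 4) : ℝ)) (B := 1)
        (Measurable.aestronglyMeasurable (by fun_prop)) fun x => ?_).norm
      rw [one_mul, abs_of_nonneg (by positivity)]
    refine (hg1.mul_prod hg2).mono' ?_ ?_
    · refine hf.1.comp_snd.mul ?_
      refine (Complex.continuous_ofReal.comp ?_).aestronglyMeasurable
      fun_prop
    · have hmem : ∀ᵐ p : ℝ × ℝ ∂((volume.restrict (Ioc 0 β)).prod volume), p.1 ∈ Ioc 0 β :=
        Measure.quasiMeasurePreserving_fst.ae (ae_restrict_mem measurableSet_Ioc)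
      filter_upwards [hmem] with p hp
      simp only [Function.uncurry]
      rw [norm_mul, norm_mul, Complex.norm_real, Complex.norm_real, Real.norm_eq_abs,
        Real.norm_eq_abs, abs_of_nonneg (by positivity : 0 ≤ (1 + |p.2|) ^ (-(3 / 4) : ℝ))]
      have h1 := (abs_modeKernel_le n (p.1 * (p.2 / n))).trans (inv_sqrt_le_rpow_mul hn hp p.2)
      calc _ ≤ ‖f p.2‖ * ((β + n) ^ (3 / 4 : ℝ) * p.1 ^ (-(3 / 4) : ℝ)
            * (1 + |p.2|) ^ (-(3 / 4) : ℝ)) := by gcongr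
        _ = _ := by ring
  calc ∫ b in (0 : ℝ)..β, modePairing f n (b / n)
      = ∫ b in Ioc 0 β, ∫ x, f x * (modeKernel n (b * (x / n)) : ℂ) := by
        rw [intervalIntegral.integral_of_le hβ.le]
        simp only [modePairing, div_mul_eq_mul_div, mul_div_assoc]
    _ = ∫ x, ∫ b in Ioc 0 β, f x * (modeKernel n (b * (x / n)) : ℂ) := integral_integral_swap hint
    _ = _ := by
        congr 1
        ext x
        rw [integral_const_mul, modeAverage, intervalIntegral.integral_of_le hβ.le,
          integral_complex_ofReal]

theorem sq_integral_modeAverage_le {γ : Signal} (heven : IsEven γ) {n : ℕ} (hn : n ≠ 0) {β : ℝ}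
    (hβ : 0 < β) : ‖∫ y, lineFun γ y * modeAverage n β y‖ₑ ^ 2
      ≤ ENNReal.ofReal (β ^ 2) * dilationEnergy γ n := by
  have hf := memLp_lineFun γ
  have hn' : (0 : ℝ) < n := by exact_mod_cast Nat.pos_of_ne_zero hn
  let J : ℝ → ℝ≥0∞ := (Ioi (0 : ℝ)).indicator fun a => ‖modePairing (lineFun γ) n a‖ₑ
  have hJ : Measurable J := by
    have h1 := continuousOn_modePairing hf n
    have h2 : ContinuousOn (fun a => ‖modePairing (lineFun γ) n a‖ₑ) (Ioi 0) :=
      continuous_enorm.comp_continuousOn h1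
    classical
    simp only [J, ← piecewise_eq_indicator]
    exact h2.measurable_piecewise continuousOn_const measurableSet_Ioi
  have h1 := sq_lintegral_Ioo_le J hJ (div_pos hβ hn')
  have h2 : ∫⁻ a in Ioi (0 : ℝ), J a ^ 2 * ENNReal.ofReal (1 / a) = dilationEnergy γ n := by
    rw [dilationEnergy_eq heven]
    refine setLIntegral_congr_fun measurableSet_Ioi fun a ha => ?_
    simp only [J, indicator_of_mem ha, Int.cast_natCast]
  have h3 : ‖∫ y, lineFun γ y * modeAverage n β y‖ₑ
      ≤ ENNReal.ofReal n * ∫⁻ a in Ioo 0 (β / n), J a := by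
    rw [← integral_modePairing hf hn hβ,
      intervalIntegral.integral_comp_div (fun a => modePairing (lineFun γ) n a) hn'.ne', zero_div,
      enorm_smul, intervalIntegral.integral_of_le (by positivity), integral_Ioc_eq_integral_Ioo]
    refine mul_le_mul' ?_ ?_
    · rw [← ofReal_norm, Real.norm_of_nonneg hn'.le]
    · refine (enorm_integral_le_lintegral_enorm _).trans_eq ?_
      refine setLIntegral_congr_fun measurableSet_Ioo fun a ha => ?_
      simp only [J, indicator_of_mem (show a ∈ Ioi (0 : ℝ) from ha.1)]
  rw [h2] at h1
  calc _ ≤ (ENNReal.ofReal n * ∫⁻ a in Ioo 0 (β / n), J a) ^ 2 := by gcongr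
    _ = ENNReal.ofReal n ^ 2 * (∫⁻ a in Ioo 0 (β / n), J a) ^ 2 := mul_pow _ _ _
    _ ≤ ENNReal.ofReal n ^ 2 * (ENNReal.ofReal ((β / n) ^ 2) * dilationEnergy γ n) := by gcongr
    _ = _ := by
        rw [← mul_assoc, ← ENNReal.ofReal_pow hn'.le, ← ENNReal.ofReal_mul (by positivity)]
        congr 2
        field_simp

theorem lineFun_not_ae_zero {γ : Signal} (hγ : γ ≠ 0) : ¬ ∀ᵐ y, lineFun γ y = 0 := by
  intro h
  have h1 : ‖γ‖ₑ ^ 2 = 0 := by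
    rw [enorm_signal_sq, lintegral_arc_eq_lintegral_arctan]
    refine (lintegral_congr_ae (g := fun _ => 0) ?_).trans lintegral_zero
    filter_upwards [h] with y hy
    have hs : (((Real.sqrt (1 + y ^ 2))⁻¹ : ℝ) : ℂ) ≠ 0 := by
      rw [Complex.ofReal_ne_zero]; positivity
    have hγy : γ (Real.arctan y) = 0 := (mul_eq_zero.1 hy).resolve_left hs
    simp [hγy]
  exact hγ (by simpa using h1)

/-- The energies of the modes are bounded away from zero at infinity. -/
theorem eventually_le_dilationEnergy {γ : Signal} (heven : IsEven γ) (hγ : γ ≠ 0) :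
    ∃ m : ℝ≥0∞, m ≠ 0 ∧ ∀ᶠ n : ℕ in atTop, m ≤ dilationEnergy γ n := by
  have hf := memLp_lineFun γ
  obtain ⟨β, hβ, hq⟩ : ∃ β > 0, ∫ y, lineFun γ y * cosAverage β y ≠ 0 := by
    by_contra! h
    exact lineFun_not_ae_zero hγ (ae_eq_zero_of_integral_mul_cosAverage hf (lineFun_even heven) h)
  set q := ∫ y, lineFun γ y * cosAverage β y
  have hlim : Tendsto (fun n : ℕ => ∫ y, lineFun γ y * modeAverage n β y) atTop (𝓝 q) := by
    have h1 := (tendsto_integral_mul_modeAverage hf hβ).add_const q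
    rw [zero_add] at h1
    refine h1.congr' ?_
    filter_upwards [eventually_ne_atTop 0] with n hn
    have hi : Integrable fun y => lineFun γ y * modeAverage n β y := by
      have hdiff : Integrable fun y => lineFun γ y * (modeAverage n β y - cosAverage β y : ℝ) := by
        obtain ⟨M, hM, hb⟩ := lintegral_sq_sub_le hβ
        have hk : MemLp (fun y => modeAverage n β y - cosAverage β y) 2 := by
          refine ⟨((continuous_modeAverage n β).sub
            (continuous_cosAverage β)).aestronglyMeasurable, ?_⟩
          rw [eLpNorm_lt_top_iff_lintegral_rpow_enorm_lt_top (by norm_num) (by norm_num)]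
          simpa using (hb n hn).trans_lt hM.lt_top
        exact hf.integrable_mul hk.ofReal
      convert! hdiff.add (integrable_mul_cosAverage hf β) using 2 with y
      simp only [Pi.add_apply]
      push_cast
      ring
    simp only [Complex.ofReal_sub, mul_sub]
    rw [integral_sub hi (integrable_mul_cosAverage hf β)]
    ring
  have hpos : 0 < ‖q‖ / 2 := by positivity
  refine ⟨ENNReal.ofReal ((‖q‖ / 2) ^ 2 / β ^ 2), by simp; positivity, ?_⟩
  filter_upwards [eventually_ne_atTop 0, hlim.norm.eventually_const_lt (by linarith : ‖q‖ / 2 < ‖q‖)]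
    with n hn hqn
  have h1 := sq_integral_modeAverage_le heven hn hβ
  rw [ENNReal.ofReal_div_of_pos (by positivity), ENNReal.div_le_iff_le_mul (by simp [hβ.ne'])
    (by simp), mul_comm]
  refine le_trans ?_ h1
  rw [ENNReal.ofReal_pow hpos.le, ← ofReal_norm]
  gcongr

end

section

open Filter Topology
open scoped ENNReal NNReal

theorem exists_le_dilationEnergy {γ : Signal} (heven : IsEven γ) (hγ : γ ≠ 0) :
    ∃ m : ℝ≥0∞, m ≠ 0 ∧ ∀ n : ℤ, m ≤ dilationEnergy γ n := by
  obtain ⟨m, hm, hev⟩ := eventually_le_dilationEnergy heven hγ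
  obtain ⟨N, hN⟩ := eventually_atTop.1 hev
  have hnat : ∀ N : ℕ, ∃ m' : ℝ≥0∞, m' ≠ 0 ∧ ∀ n : ℕ, n < N → m' ≤ dilationEnergy γ n := by
    intro N
    induction N with
    | zero => exact ⟨1, one_ne_zero, fun n hn => absurd hn n.not_lt_zero⟩
    | succ N ih =>
      obtain ⟨m', hm', h⟩ := ih
      refine ⟨min m' (dilationEnergy γ N), (lt_min (pos_iff_ne_zero.2 hm')
        (pos_iff_ne_zero.2 (dilationEnergy_ne_zero heven hγ N))).ne', fun n hn => ?_⟩
      rcases Nat.lt_succ_iff_lt_or_eq.1 hn with hn | rfl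
      · exact (min_le_left _ _).trans (h n hn)
      · exact min_le_right _ _
  obtain ⟨m', hm', h⟩ := hnat N
  have hall : ∀ n : ℕ, min m m' ≤ dilationEnergy γ n := fun n => by
    rcases lt_or_ge n N with hn | hn
    · exact (min_le_right _ _).trans (h n hn)
    · exact (min_le_left _ _).trans (hN n hn)
  refine ⟨min m m', (lt_min (pos_iff_ne_zero.2 hm) (pos_iff_ne_zero.2 hm')).ne', fun n => ?_⟩
  rcases Int.natAbs_eq n with hn | hn
  · rw [hn]; exact hall _
  · rw [hn, dilationEnergy_neg heven]; exact hall _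

theorem mul_enorm_sq_le_lintegral {γ : Signal} {m : ℝ≥0∞} (h : ∀ n : ℤ, m ≤ dilationEnergy γ n)
    (ψ : Signal) : m * ‖ψ‖ₑ ^ 2 ≤ ∫⁻ q, ‖inner ℂ (wavelet γ q) ψ‖ₑ ^ 2 ∂paramMeasure := by
  rw [lintegral_inner_wavelet, enorm_signal_sq, lintegral_enorm_sq_eq_tsum (Lp.memLp ψ),
    mul_left_comm, ← ENNReal.tsum_mul_left]
  gcongr
  exact h _

end

end CircleWavelet

theorem proposition2 (γ : CircleWavelet.Signal) (hadm : CircleWavelet.IsAdmissible γ)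
    (heven : CircleWavelet.IsEven γ) :
    CircleWavelet.IsContinuousFrame CircleWavelet.paramMeasure (CircleWavelet.wavelet γ) := by
  have hmeas := CircleWavelet.measurable_inner_wavelet γ
  obtain ⟨C, hC, hupper⟩ := CircleWavelet.exists_bessel_bound hmeas hadm.2
  obtain ⟨m, hm, hlower⟩ := CircleWavelet.exists_le_dilationEnergy heven hadm.1
  have hm1 : min m 1 ≠ ⊤ := (min_lt_of_right_lt ENNReal.one_lt_top).ne
  have hm0 : min m 1 ≠ 0 := (lt_min (pos_iff_ne_zero.2 hm) one_pos).ne'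
  have hc : 0 < (min m 1).toReal := ENNReal.toReal_pos hm0 hm1
  refine ⟨hmeas, (min m 1).toReal, C + (min m 1).toReal, hc, by linarith, fun ψ => ⟨?_, ?_⟩⟩
  · rw [ENNReal.ofReal_mul hc.le, ENNReal.ofReal_toReal hm1, ENNReal.ofReal_pow (norm_nonneg _),
      ofReal_norm]
    exact CircleWavelet.mul_enorm_sq_le_lintegral (fun n => (min_le_left _ _).trans (hlower n)) ψ
  · refine (hupper ψ).trans (ENNReal.ofReal_le_ofReal ?_)
    gcongr
    linarith
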